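/- Let $q\neq 2$ be a prime power, let $D,N$ be integers with $N>2D\ge 6$, and let $\Gamma$ be the bilinear forms graph $H_q(D,N-D)$: its vertex set $X$ consists of the $D\times(N-D)$ matrices over $\mathrm{GF}(q)$, and two matrices are adjacent when their difference has rank one. Let $\partial$ be the path-length distance of $\Gamma$ and $\Gamma_i(x)=\{z\in X:\partial(x,z)=i\}$, $\Gamma(x)=\Gamma_1(x)$. Let $A$ be the adjacency matrix of $\Gamma$, acting on $V=\mathbb R^X$, and let $E\in\mathrm{Mat}_X(\mathbb R)$ be the primitive idempotent for the second largest eigenvalue $\theta_1$ of $A$ (that is, $E$ acts as the identity on the $\theta_1$-eigenspace of $A$ and as $0$ on every other eigenspace). For $x\in X$ let $\hat x\in V$ be its characteristic vector, and for $\Omega\subseteq X$ put $\widehat\Omega=\sum_{z\in\Omega}\hat z$. For $u,v\in EV$ let $u\star v=E(u\circ v)$ (the Norton product), where $\circ$ is the entry-wise product. Fix $x,y\in X$ and assume that $k=\partial(x,y)$ satisfies $2\le k\le D-1$. Let $O_1=\Gamma(x)\cap\Gamma_{k-1}(y)$, $O_6=\Gamma(x)\cap\Gamma_{k+1}(y)$,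 and for $2\le i\le 5$ let $O_i$ be the set of $z\in\Gamma(x)\cap\Gamma_k(y)$ such that $$\bigl(|\Gamma(x)\cap\Gamma(z)\cap\Gamma_{k-1}(y)|,\ |\Gamma(x)\cap\Gamma(z)\cap\Gamma_{k+1}(y)|\bigr)$$ equals $(2q^{k-1},0)$, $(2q^{k-1}-1,0)$, $(q^{k-1},q^D-q^k)$, $(q^{k-1},q^{N-D}-q^k)$ for $i=2,3,4,5$ respectively. Write $$a=\tfrac{q^D-q^k}{q-1},\quad b=\tfrac{q^{N-D}-q^k}{q-1},\quad c=\tfrac{q^k-1}{q-1},\quad f=\tfrac{q^N-q^{N-D+1}-q^{D+1}+q^{k+1}-q^k+q}{(q-1)^2},\quad g=\tfrac{(q^D-q^k)(q^{N-D}-q^k)(q^{k-1}-1)}{q^k(q-1)},$$ and let $$H=\begin{pmatrix} 1&a&b&q-2&f&g\\ 1&a&b&0&\frac{q^k-q^N}{q-1}&\frac{(q^D-q^k)(q^{N-D}-q^k)}{q(q-1)}\\ 1&a&b&-1&f&g\\ 1&a&-c&0&\frac{q^k-q^D}{q-1}&-\frac{(q^D-q^k)(q^{k-1}-1)}{q-1}\\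 1&-c&b&0&\frac{q^k-q^{N-D}}{q-1}&-\frac{(q^{N-D}-q^k)(q^{k-1}-1)}{q-1}\\ 1&-c&-c&0&c&\frac{(q^k-1)(q^{k-1}-1)}{q-1} \end{pmatrix},\qquad h_j=\sum_{i=1}^6H_{i,j}\,E\widehat O_i\quad(1\le j\le 6).$$ Then for $1\le j\le 6$, $$E\hat x\star h_j=|X|^{-1}\vartheta_j h_j,$$ where $(\vartheta_1,\dots,\vartheta_6)=\bigl(q^{N-D}+q^D-q-2,\ q^{N-D}-q-1,\ q^D-q-1,\ -1,\ -q,\ -q\bigr)$. -/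

import Mathlib

namespace BalancedSet

section Generic

variable {X : Type*} [Fintype X] [DecidableEq X]

/-- The eigenvalues of a real square matrix `A`: the roots of the minimal polynomial of `A`. -/
noncomputable def eigenvalueSet (A : Matrix X X ℝ) : Set ℝ :=
  {θ | (minpoly ℝ A).IsRoot θ}

/-- The second largest of the distinct eigenvalues of `A`, i.e. `θ₁` in the ordering
`θ₀ > θ₁ > ⋯` of the (finitely many) eigenvalues of `A`. -/
noncomputable def secondLargestEigenvalue (A : Matrix X X ℝ) : ℝ :=
  sSup {θ | θ ∈ eigenvalueSet A ∧ θ < sSup (eigenvalueSet A)}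

/-- `E` is the primitive idempotent of the square matrix `A` associated with the scalar `θ`: it acts
as the identity on the `θ`-eigenspace of `A`, and as `0` on every other eigenspace of `A`. -/
def IsPrimitiveIdempotent (A : Matrix X X ℝ) (θ : ℝ) (E : Matrix X X ℝ) : Prop :=
  (∀ v : X → ℝ, A.mulVec v = θ • v → E.mulVec v = v) ∧
    ∀ η : ℝ, η ≠ θ → ∀ v : X → ℝ, A.mulVec v = η • v → E.mulVec v = 0

/-- For a real symmetric matrix the primitive idempotent exists and is unique. -/
theorem existsUnique_isPrimitiveIdempotent {A : Matrix X X ℝ} (hA : A.IsHermitian) (θ : ℝ) :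
    ∃! E : Matrix X X ℝ, IsPrimitiveIdempotent A θ E := by
  have hT : (Matrix.toEuclideanLin A).IsSymmetric := Matrix.isSymmetric_toEuclideanLin_iff.2 hA
  have mem : ∀ (η : ℝ) (v : X → ℝ), A.mulVec v = η • v →
      WithLp.toLp 2 v ∈ Module.End.eigenspace (Matrix.toEuclideanLin A) η := by
    intro η v hv
    rw [Module.End.mem_eigenspace_iff, Matrix.toLpLin_toLp, Matrix.toLin'_apply, hv]
    rfl
  set P : EuclideanSpace ℝ X →ₗ[ℝ] EuclideanSpace ℝ X :=
    ((Module.End.eigenspace (Matrix.toEuclideanLin A) θ).starProjection :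
      EuclideanSpace ℝ X →L[ℝ] EuclideanSpace ℝ X).toLinearMap with hP
  have hE : ∀ v : X → ℝ, (Matrix.toEuclideanLin.symm P).mulVec v = (P (WithLp.toLp 2 v)).ofLp := by
    intro v
    rw [← Matrix.toLin'_apply, ← Matrix.ofLp_toLpLin 2 2 _ (WithLp.toLp 2 v),
      LinearEquiv.apply_symm_apply]
  refine ⟨Matrix.toEuclideanLin.symm P, ⟨?_, ?_⟩, ?_⟩
  · intro v hv
    rw [hE]
    have : P (WithLp.toLp 2 v) = WithLp.toLp 2 v :=
      Submodule.starProjection_eq_self_iff.2 (mem θ v hv)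
    rw [this]
  · intro η hη v hv
    rw [hE]
    have : P (WithLp.toLp 2 v) = 0 := by
      refine (Submodule.starProjection_apply_eq_zero_iff _).2 ?_
      rw [Submodule.mem_orthogonal]
      intro w hw
      exact hT.orthogonalFamily_eigenspaces (Ne.symm hη) ⟨w, hw⟩ ⟨_, mem η v hv⟩
    rw [this]
    rfl
  · intro E' hE'
    have h1 : ∀ i, A.mulVec (hA.eigenvectorBasis i).ofLp
        = hA.eigenvalues i • (hA.eigenvectorBasis i).ofLp := hA.mulVec_eigenvectorBasis
    apply Matrix.toEuclideanLin.injective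
    rw [LinearEquiv.apply_symm_apply]
    refine hA.eigenvectorBasis.toBasis.ext fun i => ?_
    rw [OrthonormalBasis.coe_toBasis, Matrix.toLpLin_apply]
    by_cases h : hA.eigenvalues i = θ
    · rw [hE'.1 _ (by rw [h1, h])]
      exact (Submodule.starProjection_eq_self_iff.2 (mem θ _ (by rw [h1, h]))).symm
    · rw [hE'.2 _ h _ (h1 i)]
      symm
      refine (Submodule.starProjection_apply_eq_zero_iff _).2 ?_
      rw [Submodule.mem_orthogonal]
      intro w hw
      exact hT.orthogonalFamily_eigenspaces (Ne.symm h) ⟨w, hw⟩ ⟨_, mem _ _ (h1 i)⟩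

/-- The primitive idempotent of a real symmetric matrix `A` associated with `θ`. -/
noncomputable def primitiveIdempotent {A : Matrix X X ℝ} (hA : A.IsHermitian) (θ : ℝ) :
    Matrix X X ℝ :=
  (existsUnique_isPrimitiveIdempotent hA θ).choose

/-- The defining property of `primitiveIdempotent`. -/
theorem isPrimitiveIdempotent_primitiveIdempotent {A : Matrix X X ℝ} (hA : A.IsHermitian) (θ : ℝ) :
    IsPrimitiveIdempotent A θ (primitiveIdempotent hA θ) :=
  (existsUnique_isPrimitiveIdempotent hA θ).choose_spec.1

/-- The subspace `EV` of the standard module `V = ℝ^X`. -/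
abbrev imageSpace (E : Matrix X X ℝ) : Submodule ℝ (X → ℝ) :=
  LinearMap.range E.mulVecLin

/-- The map `V → EV`, `v ↦ E v`. -/
def toImage (E : Matrix X X ℝ) : (X → ℝ) →ₗ[ℝ] imageSpace E :=
  E.mulVecLin.rangeRestrict

/-- The Norton product `u ⋆ v = E (u ∘ v)` on `EV`, where `∘` is the entry-wise product. -/
def nortonMul (E : Matrix X X ℝ) (u v : imageSpace E) : imageSpace E :=
  toImage E ((u : X → ℝ) * (v : X → ℝ))

/-- The characteristic vector `x̂` of a vertex `x`. -/
def hatVec (x : X) : X → ℝ := Pi.single x 1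

/-- The characteristic vector `Ω̂ = ∑_{z ∈ Ω} ẑ` of a set of vertices `Ω`. -/
def hatSet (Ω : Finset X) : X → ℝ := ∑ z ∈ Ω, hatVec z

/-- `Γ_i(x)`, the set of vertices at (path-length) distance `i` from `x`. -/
noncomputable def sphere (G : SimpleGraph X) (i : ℕ) (x : X) : Finset X :=
  Finset.univ.filter fun y => G.dist x y = i

end Generic

section Bilinear

/-- The vertices of the bilinear forms graph: the `D × (N - D)` matrices over `F`. -/
abbrev Vertex (F : Type*) (D N : ℕ) : Type _ := Matrix (Fin D) (Fin (N - D)) F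

/-- The bilinear forms graph `H_q(D, N - D)`: two matrices are adjacent whenever their difference
has rank one. -/
def bilinearFormsGraph (F : Type*) [Field F] (D N : ℕ) : SimpleGraph (Vertex F D N) where
  Adj x y := (x - y).rank = 1
  symm := ⟨fun x y h => by
    have e : (y - x).rank = (x - y).rank := by
      have e' : (-(x - y)).mulVecLin = -(x - y).mulVecLin := by
        ext1 v
        simp
      rw [← neg_sub x y, Matrix.rank, Matrix.rank, e', LinearMap.range_neg]
    exact e.trans h⟩
  loopless := ⟨fun x h => by simp at h⟩

noncomputable instance bilinearFormsGraphDecidableRel (F : Type*) [Field F] (D N : ℕ) :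
    DecidableRel (bilinearFormsGraph F D N).Adj := fun _ _ => Classical.propDecidable _

variable (F : Type*) [Field F] [Fintype F] [DecidableEq F] (D N : ℕ)

/-- The primitive idempotent `E` of the bilinear forms graph that corresponds to the second largest
eigenvalue `θ₁` of its adjacency matrix. -/
noncomputable def E₁ : Matrix (Vertex F D N) (Vertex F D N) ℝ :=
  primitiveIdempotent ((bilinearFormsGraph F D N).isHermitian_adjMatrix (R := ℝ))
    (secondLargestEigenvalue ((bilinearFormsGraph F D N).adjMatrix ℝ))

variable {F D N}

/-- The set of `z ∈ Γ(x) ∩ Γ_k(y)`, where `k = ∂(x,y)`, such that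
`|Γ(x) ∩ Γ(z) ∩ Γ_{k-1}(y)| = m` and `|Γ(x) ∩ Γ(z) ∩ Γ_{k+1}(y)| = n`. -/
noncomputable def middlePart (x y : Vertex F D N) (m n : ℕ) : Finset (Vertex F D N) :=
  let G := bilinearFormsGraph F D N
  let k := G.dist x y
  (sphere G 1 x ∩ sphere G k y).filter fun z =>
    (sphere G 1 x ∩ sphere G 1 z ∩ sphere G (k - 1) y).card = m ∧
      (sphere G 1 x ∩ sphere G 1 z ∩ sphere G (k + 1) y).card = n

/-- The `y`-partition `O₁, …, O₆` of `Γ(x)` (indexed by `0, …, 5`), where `k = ∂(x,y)`. -/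
noncomputable def yPartition (x y : Vertex F D N) : Fin 6 → Finset (Vertex F D N) :=
  let G := bilinearFormsGraph F D N
  let k := G.dist x y
  let q := Fintype.card F
  ![sphere G 1 x ∩ sphere G (k - 1) y,
    middlePart x y (2 * q ^ (k - 1)) 0,
    middlePart x y (2 * q ^ (k - 1) - 1) 0,
    middlePart x y (q ^ (k - 1)) (q ^ D - q ^ k),
    middlePart x y (q ^ (k - 1)) (q ^ (N - D) - q ^ k),
    sphere G 1 x ∩ sphere G (k + 1) y]

end Bilinear

/-- The `6 × 6` matrix `H` with parameters `q, D, N, k`. -/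
noncomputable def HMatrix (q : ℝ) (D N k : ℕ) : Matrix (Fin 6) (Fin 6) ℝ :=
  let f := (q ^ N - q ^ (N - D + 1) - q ^ (D + 1) + q ^ (k + 1) - q ^ k + q) / (q - 1) ^ 2
  let g := (q ^ D - q ^ k) * (q ^ (N - D) - q ^ k) * (q ^ (k - 1) - 1) / (q ^ k * (q - 1))
  let a := (q ^ D - q ^ k) / (q - 1)
  let b := (q ^ (N - D) - q ^ k) / (q - 1)
  let c := (q ^ k - 1) / (q - 1)
  !![1,  a,  b, q - 2,                               f,                                       g;
     1,  a,  b,     0,     (q ^ k - q ^ N) / (q - 1),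
                            (q ^ D - q ^ k) * (q ^ (N - D) - q ^ k) / (q * (q - 1));
     1,  a,  b,    -1,                               f,                                       g;
     1,  a, -c,     0,     (q ^ k - q ^ D) / (q - 1),
                            -((q ^ D - q ^ k) * (q ^ (k - 1) - 1) / (q - 1));
     1, -c,  b,     0, (q ^ k - q ^ (N - D)) / (q - 1),
                            -((q ^ (N - D) - q ^ k) * (q ^ (k - 1) - 1) / (q - 1));
     1, -c, -c,     0,                               c,
                            (q ^ k - 1) * (q ^ (k - 1) - 1) / (q - 1)]

/-- The scalars `ϑ₁, …, ϑ₆` (indexed by `0, …, 5`). -/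
def vartheta (q : ℝ) (D N : ℕ) : Fin 6 → ℝ :=
  ![q ^ (N - D) + q ^ D - q - 2, q ^ (N - D) - q - 1, q ^ D - q - 1, -1, -q, -q]

/-- The vectors `h_j = ∑_i H_{i,j} E Ô_i` in `EV` (indexed by `0, …, 5`), where `k = ∂(x,y)`. -/
noncomputable def hVec {F : Type*} [Field F] [Fintype F] [DecidableEq F] {D N : ℕ}
    (x y : Vertex F D N) (j : Fin 6) : imageSpace (E₁ F D N) :=
  ∑ i : Fin 6, HMatrix (Fintype.card F) D N ((bilinearFormsGraph F D N).dist x y) i j •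
    toImage (E₁ F D N) (hatSet (yPartition x y i))

end BalancedSet

open Matrix

/-! The graph is a Cayley graph on the additive group of matrices, so it is diagonalized by the
characters `χ (pairing C ·)` for a fixed nontrivial `χ`. The eigenvalue depends only on the rank of
`C` and strictly decreases with it (`sum_rank_one_addChar`, `theta_lt_theta`). Hence `E₁` keeps
exactly the frequencies of rank one, and its entry at `(z, w)` is `theta` at the rank of `z - w`,
divided by `|X|` (`E₁_eq_thetaKernel`).

The core is `nortonMul_adjacent`: for adjacent `x` and `z`, the Norton product of `E x̂` and `E ẑ`
is `|X|⁻¹` times the sum of `E ŵ` over the common neighbours `w`. Expanding the product in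
characters gives sums over common neighbours of `0` and a rank one frequency `C`, evaluated at `x -
z`. By the reciprocity `sum_common_neighbors_addChar` the roles of `C` and `x - z` may be exchanged,
which turns these sums over frequencies into sums over vertices. Norton multiplication by `E x̂`
thus acts on the vectors `E ẑ`, `z ∈ Γ(x)`, as the local graph at `x` does, up to the factor `|X|⁻¹`
(`nortonMul_local_eigenvector`).

It remains to see that each column of `H`, read as a function constant on the cells of the
`y`-partition, is an eigenvector of the local graph. Write `z = x + s ⊗ t` and `Y = y - x`. The cell
of `z` is determined by whether `s` lies in the column space of `Y`, whether `t` lies in its row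
space, and, if both hold, whether a bilinear form takes the value `1`, `0` or another value at `(s,
t)` (`sum_yPartition_eq_weight`). Neighbour sums of such functions have a closed form
(`sum_neighbors_weight`), and the eigenvector equations become the rational identities of
`HMatrix_quotient_eq`. -/

namespace BalancedSet

/-! ### Rank one matrices and the local graph at zero. -/

section RankLemmas

set_option linter.unusedSectionVars false

variable {F : Type*} [Field F] {m n l : Type*} [Fintype m] [Fintype n] [Fintype l]
  [DecidableEq m] [DecidableEq n] [DecidableEq l]

theorem rank_add_le (A B : Matrix m n F) : (A + B).rank ≤ A.rank + B.rank := by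
  have h : LinearMap.range (A + B).mulVecLin ≤
      LinearMap.range A.mulVecLin ⊔ LinearMap.range B.mulVecLin := by
    rintro _ ⟨v, rfl⟩
    rw [Matrix.mulVecLin_add, LinearMap.add_apply]
    exact Submodule.add_mem_sup ⟨v, rfl⟩ ⟨v, rfl⟩
  exact (Submodule.finrank_mono h).trans (Submodule.finrank_add_le_finrank_add_finrank _ _)

theorem rank_neg (A : Matrix m n F) : (-A).rank = A.rank := by
  have e : (-A).mulVecLin = -A.mulVecLin := by
    ext1 v
    simp
  rw [Matrix.rank, Matrix.rank, e, LinearMap.range_neg]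

theorem rank_sub_comm (A B : Matrix m n F) : (A - B).rank = (B - A).rank := by
  rw [← rank_neg, neg_sub]

theorem rank_eq_zero_iff {A : Matrix m n F} : A.rank = 0 ↔ A = 0 := by
  constructor
  · intro h
    rw [Matrix.rank, Submodule.finrank_eq_zero, LinearMap.range_eq_bot] at h
    ext i j
    have := congrFun (LinearMap.congr_fun h (Pi.single j 1)) i
    simpa using this
  · rintro rfl
    simp

theorem exists_rank_factorization (Y : Matrix m n F) {k : ℕ} (hk : Y.rank = k) :
    ∃ (P : Matrix m (Fin k) F) (Q : Matrix (Fin k) n F) (P' : Matrix (Fin k) m F)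
      (Q' : Matrix n (Fin k) F), Y = P * Q ∧ P' * P = 1 ∧ Q * Q' = 1 := by
  set e := (Module.finBasisOfFinrankEq F (LinearMap.range Y.mulVecLin) hk).equivFun with he
  set i : (Fin k → F) →ₗ[F] (m → F) :=
    (LinearMap.range Y.mulVecLin).subtype ∘ₗ e.symm.toLinearMap with hi
  set p : (n → F) →ₗ[F] (Fin k → F) := e.toLinearMap ∘ₗ Y.mulVecLin.rangeRestrict with hp
  obtain ⟨i', hi'⟩ := i.exists_leftInverse_of_injective (LinearMap.ker_eq_bot.2 (by
    rw [hi, LinearMap.coe_comp]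
    exact Subtype.val_injective.comp e.symm.injective))
  obtain ⟨p', hp'⟩ := p.exists_rightInverse_of_surjective (LinearMap.range_eq_top.2 (by
    rw [hp, LinearMap.coe_comp]
    exact e.surjective.comp (LinearMap.surjective_rangeRestrict _)))
  refine ⟨LinearMap.toMatrix' i, LinearMap.toMatrix' p, LinearMap.toMatrix' i',
    LinearMap.toMatrix' p', ?_, ?_, ?_⟩
  · rw [← LinearMap.toMatrix'_comp]
    have : i ∘ₗ p = Y.mulVecLin := by
      refine LinearMap.ext fun v => ?_
      simp [hi, hp]
    rw [this, ← Matrix.toLin'_apply', LinearMap.toMatrix'_toLin']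
  · rw [← LinearMap.toMatrix'_comp, hi', LinearMap.toMatrix'_id]
  · rw [← LinearMap.toMatrix'_comp, hp', LinearMap.toMatrix'_id]

theorem vecMulVec_eq_zero_iff {u : m → F} {v : n → F} :
    vecMulVec u v = 0 ↔ u = 0 ∨ v = 0 := by
  constructor
  · intro h
    by_contra! hc
    obtain ⟨i, hi⟩ := Function.ne_iff.1 hc.1
    obtain ⟨j, hj⟩ := Function.ne_iff.1 hc.2
    have := congrFun (congrFun h i) j
    rw [vecMulVec_apply] at this
    exact mul_ne_zero hi hj this
  · rintro (rfl | rfl) <;> ext i j <;> simp [vecMulVec_apply]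

theorem rank_vecMulVec_eq_one {u : m → F} {v : n → F} (hu : u ≠ 0) (hv : v ≠ 0) :
    (vecMulVec u v).rank = 1 := by
  have h0 : (vecMulVec u v).rank ≠ 0 := by
    rw [Ne, rank_eq_zero_iff, vecMulVec_eq_zero_iff]
    tauto
  have := Matrix.rank_vecMulVec_le u v
  omega

theorem exists_eq_vecMulVec_of_rank_eq_one {A : Matrix m n F} (hA : A.rank = 1) :
    ∃ (u : m → F) (v : n → F), u ≠ 0 ∧ v ≠ 0 ∧ A = vecMulVec u v := by
  obtain ⟨P, Q, -, -, h, -, -⟩ := exists_rank_factorization A hA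
  have e : A = vecMulVec (fun i => P i 0) (Q 0) := by
    rw [h]
    ext i j
    simp [Matrix.mul_apply, vecMulVec_apply]
  have h0 : A ≠ 0 := by
    rintro rfl
    simp at hA
  rw [e, Ne, vecMulVec_eq_zero_iff, not_or] at h0
  exact ⟨_, _, h0.1, h0.2, e⟩

/-- A vector outside a subspace is separated from it by the dot product with some vector. -/
theorem exists_dotProduct_ne_zero {p : Submodule F (n → F)} {b : n → F} (hb : b ∉ p) :
    ∃ x : n → F, b ⬝ᵥ x ≠ 0 ∧ ∀ v ∈ p, v ⬝ᵥ x = 0 := by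
  obtain ⟨f, hf, hp⟩ := Submodule.exists_le_ker_of_notMem hb
  have e : ∀ v, f v = v ⬝ᵥ fun j => f (Pi.single j 1) := by
    intro v
    conv_lhs => rw [pi_eq_sum_univ' v]
    simp [dotProduct]
  refine ⟨fun j => f (Pi.single j 1), ?_, fun v hv => ?_⟩
  · rwa [← e]
  · rw [← e]
    exact hp hv

/-- If `b` and `v` are independent, testing on a vector orthogonal to `v` but not to `b`, and on one
orthogonal to `b` but not to `v`, puts both `a` and `u` on the line of the single column `c` of the
difference. This forces common neighbours of `0` and `u ⊗ v` to share its column space or its row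
space. -/
theorem parallel_of_rank_sub_le_one {u a : m → F} {v b : n → F} (hu : u ≠ 0) (hb : b ≠ 0)
    (h : (vecMulVec a b - vecMulVec u v).rank ≤ 1) :
    (∃ c : F, a = c • u) ∨ ∃ c : F, v = c • b := by
  by_cases hvb : ∃ c : F, v = c • b
  · exact Or.inr hvb
  by_cases hv : ∃ c : F, b = c • v
  · obtain ⟨c, hc⟩ := hv
    have hc0 : c ≠ 0 := by
      rintro rfl
      exact hb (by simpa using hc)
    exact Or.inr ⟨c⁻¹, by rw [hc, smul_smul, inv_mul_cancel₀ hc0, one_smul]⟩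
  left
  obtain ⟨c, d, hcd⟩ : ∃ (c : m → F) (d : n → F),
      vecMulVec a b - vecMulVec u v = vecMulVec c d := by
    rcases Nat.le_one_iff_eq_zero_or_eq_one.1 h with h | h
    · exact ⟨0, 0, by rw [rank_eq_zero_iff.1 h, vecMulVec_eq_zero_iff.2 (Or.inl rfl)]⟩
    · obtain ⟨c, d, -, -, h⟩ := exists_eq_vecMulVec_of_rank_eq_one h
      exact ⟨c, d, h⟩
  have key : ∀ y : n → F, (b ⬝ᵥ y) • a - (v ⬝ᵥ y) • u = (d ⬝ᵥ y) • c := by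
    intro y
    have := congrArg (fun A => A *ᵥ y) hcd
    simpa [Matrix.sub_mulVec, Matrix.vecMulVec_mulVec] using this
  have separate : ∀ {r s : n → F}, (¬∃ c : F, r = c • s) → ∃ x, r ⬝ᵥ x ≠ 0 ∧ s ⬝ᵥ x = 0 := by
    intro r s hrs
    have hmem : r ∉ Submodule.span F {s} := by
      rw [Submodule.mem_span_singleton]
      rintro ⟨c, hc⟩
      exact hrs ⟨c, hc.symm⟩
    obtain ⟨x, hx, hx'⟩ := exists_dotProduct_ne_zero hmem
    exact ⟨x, hx, hx' s (Submodule.mem_span_singleton_self s)⟩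
  obtain ⟨x, hx, hx'⟩ := separate hv
  obtain ⟨y, hy, hy'⟩ := separate hvb
  have k1 := key x
  have k2 := key y
  rw [hx', zero_smul, sub_zero] at k1
  rw [hy', zero_smul, zero_sub] at k2
  have hdy : d ⬝ᵥ y ≠ 0 := by
    intro h0
    rw [h0, zero_smul, neg_eq_zero, smul_eq_zero] at k2
    exact k2.elim hy hu
  have hc : c = (d ⬝ᵥ y)⁻¹ • -((v ⬝ᵥ y) • u) := by
    rw [k2, smul_smul, inv_mul_cancel₀ hdy, one_smul]
  refine ⟨(b ⬝ᵥ x)⁻¹ * (d ⬝ᵥ x) * ((d ⬝ᵥ y)⁻¹ * -(v ⬝ᵥ y)), ?_⟩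
  have ha : a = (b ⬝ᵥ x)⁻¹ • ((d ⬝ᵥ x) • c) := by
    rw [← k1, smul_smul, inv_mul_cancel₀ hx, one_smul]
  rw [ha, hc, ← neg_smul]
  simp only [smul_smul]
  congr 1
  ring

variable [Fintype F] [DecidableEq F]

/-- The sum over the common neighbours of `0` and of a rank one matrix `u ⊗ v`. -/
theorem sum_common_neighbors {R : Type*} [AddCommGroup R] (f : Matrix m n F → R)
    {u : m → F} {v : n → F} (hu : u ≠ 0) (hv : v ≠ 0) :
    ∑ Z : Matrix m n F with Z.rank = 1 ∧ (Z - vecMulVec u v).rank = 1, f Z =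
      ∑ t : n → F with t ≠ 0, f (vecMulVec u t) + ∑ s : m → F with s ≠ 0, f (vecMulVec s v) -
        ∑ c : F with c ≠ 0, f (c • vecMulVec u v) - f (vecMulVec u v) := by
  obtain ⟨i, hi⟩ := Function.ne_iff.1 hu
  obtain ⟨j, hj⟩ := Function.ne_iff.1 hv
  have injR : Function.Injective fun t : n → F => vecMulVec u t := by
    intro t t' h
    ext l
    have := congrFun (congrFun h i) l
    simp only [vecMulVec_apply] at this
    exact mul_left_cancel₀ hi this
  have injL : Function.Injective fun s : m → F => vecMulVec s v := by
    intro t t' h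
    ext l
    have := congrFun (congrFun h l) j
    simp only [vecMulVec_apply] at this
    exact mul_right_cancel₀ hj this
  have h0 : vecMulVec u v ≠ 0 := by
    rw [Ne, vecMulVec_eq_zero_iff]
    tauto
  have injC : Function.Injective fun c : F => c • vecMulVec u v := smul_left_injective F h0
  -- Inclusion-exclusion: `A` collects the matrices with the column space of `u ⊗ v`, `B` those with
  -- its row space, and they meet in the nonzero multiples. The union also contains `u ⊗ v` itself,
  -- which is not its own neighbour; hence the last subtracted term.
  set A := (Finset.univ.filter fun t : n → F => t ≠ 0).image fun t => vecMulVec u t with hA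
  set B := (Finset.univ.filter fun s : m → F => s ≠ 0).image fun s => vecMulVec s v with hB
  have hmemA : ∀ Z, Z ∈ A ↔ ∃ t ≠ 0, vecMulVec u t = Z := by simp [hA]
  have hmemB : ∀ Z, Z ∈ B ↔ ∃ s ≠ 0, vecMulVec s v = Z := by simp [hB]
  have hAB : A ∩ B = (Finset.univ.filter fun c : F => c ≠ 0).image fun c => c • vecMulVec u v := by
    ext Z
    simp only [Finset.mem_inter, hmemA, hmemB, Finset.mem_image, Finset.mem_filter,
      Finset.mem_univ, true_and]
    constructor
    · rintro ⟨⟨t, ht, rfl⟩, s, hs, h⟩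
      refine ⟨(u i)⁻¹ * s i, mul_ne_zero (inv_ne_zero hi) ?_, ?_⟩
      · intro hs0
        obtain ⟨l, hl⟩ := Function.ne_iff.1 ht
        have := congrFun (congrFun h i) l
        simp only [vecMulVec_apply, hs0, zero_mul] at this
        exact mul_ne_zero hi hl this.symm
      · rw [← vecMulVec_smul]
        congr 1
        ext l
        have := congrFun (congrFun h i) l
        simp only [vecMulVec_apply] at this
        simp only [Pi.smul_apply, smul_eq_mul, mul_assoc, this]
        rw [← mul_assoc, inv_mul_cancel₀ hi, one_mul]
    · rintro ⟨c, hc, rfl⟩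
      exact ⟨⟨c • v, smul_ne_zero hc hv, by rw [vecMulVec_smul]⟩,
        ⟨c • u, smul_ne_zero hc hu, by rw [smul_vecMulVec]⟩⟩
  have hunion : A ∪ B = insert (vecMulVec u v) (Finset.univ.filter fun Z : Matrix m n F =>
      Z.rank = 1 ∧ (Z - vecMulVec u v).rank = 1) := by
    ext Z
    simp only [Finset.mem_union, hmemA, hmemB, Finset.mem_insert, Finset.mem_filter,
      Finset.mem_univ, true_and]
    constructor
    · rintro (⟨t, ht, rfl⟩ | ⟨s, hs, rfl⟩)
      · by_cases h : t = v
        · exact Or.inl (by rw [h])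
        · refine Or.inr ⟨rank_vecMulVec_eq_one hu ht, ?_⟩
          rw [← vecMulVec_sub]
          exact rank_vecMulVec_eq_one hu (sub_ne_zero.2 h)
      · by_cases h : s = u
        · exact Or.inl (by rw [h])
        · refine Or.inr ⟨rank_vecMulVec_eq_one hs hv, ?_⟩
          rw [← sub_vecMulVec]
          exact rank_vecMulVec_eq_one (sub_ne_zero.2 h) hv
    · rintro (rfl | ⟨h1, h2⟩)
      · exact Or.inl ⟨v, hv, rfl⟩
      · obtain ⟨a, b, ha, hb, rfl⟩ := exists_eq_vecMulVec_of_rank_eq_one h1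
        rcases parallel_of_rank_sub_le_one hu hb h2.le with ⟨c, rfl⟩ | ⟨c, rfl⟩
        · refine Or.inl ⟨c • b, smul_ne_zero (fun h => ha (by rw [h, zero_smul])) hb, ?_⟩
          rw [vecMulVec_smul, smul_vecMulVec]
        · have hc : c ≠ 0 := fun h => hv (by rw [h, zero_smul])
          refine Or.inr ⟨c⁻¹ • a, smul_ne_zero (inv_ne_zero hc) ha, ?_⟩
          rw [vecMulVec_smul, smul_vecMulVec, smul_smul, mul_inv_cancel₀ hc, one_smul]
  have hsum := Finset.sum_union_inter (s₁ := A) (s₂ := B) (f := f)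
  rw [hAB, hunion, Finset.sum_insert (by simp), hA, hB, Finset.sum_image injR.injOn,
    Finset.sum_image injL.injOn, Finset.sum_image injC.injOn] at hsum
  rw [← hsum]
  abel

/-- Sums over rank one matrices in terms of sums over pairs of nonzero vectors. -/
theorem sum_rank_one {R : Type*} [AddCommGroup R] (f : Matrix m n F → R) :
    (Fintype.card F - 1) • ∑ Z : Matrix m n F with Z.rank = 1, f Z =
      ∑ s : m → F with s ≠ 0, ∑ t : n → F with t ≠ 0, f (vecMulVec s t) := by
  have hmaps : ∀ p ∈ (Finset.univ.filter fun s : m → F => s ≠ 0) ×ˢ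
      (Finset.univ.filter fun t : n → F => t ≠ 0), vecMulVec p.1 p.2 ∈
      Finset.univ.filter fun Z : Matrix m n F => Z.rank = 1 := by
    intro p hp
    simp only [Finset.mem_product, Finset.mem_filter, Finset.mem_univ, true_and] at hp ⊢
    exact rank_vecMulVec_eq_one hp.1 hp.2
  rw [← Finset.sum_product', ← Finset.sum_fiberwise_of_maps_to hmaps, Finset.smul_sum]
  refine Finset.sum_congr rfl fun Z hZ => ?_
  obtain ⟨u, v, hu, hv, rfl⟩ := exists_eq_vecMulVec_of_rank_eq_one (Finset.mem_filter.1 hZ).2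
  have hcard : Fintype.card F - 1 = (Finset.univ.filter fun c : F => c ≠ 0).card := by
    rw [Finset.filter_ne', Finset.card_erase_of_mem (Finset.mem_univ _), Finset.card_univ]
  rw [Finset.sum_congr rfl (g := fun _ => f (vecMulVec u v)) (fun p hp => by
    rw [(Finset.mem_filter.1 hp).2]), Finset.sum_const, hcard]
  congr 1
  -- The factors of a rank one matrix are unique up to scaling one by `c` and the other by `c⁻¹`.
  refine Finset.card_bij (fun c _ => (c • u, c⁻¹ • v)) ?_ ?_ ?_
  · intro c hc
    have hc : c ≠ 0 := by simpa using hc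
    simp only [Finset.mem_filter, Finset.mem_product, Finset.mem_univ, true_and]
    refine ⟨⟨smul_ne_zero hc hu, smul_ne_zero (inv_ne_zero hc) hv⟩, ?_⟩
    rw [vecMulVec_smul, smul_vecMulVec, smul_smul, inv_mul_cancel₀ hc, one_smul]
  · intro c _ c' _ h
    exact smul_left_injective F hu (Prod.ext_iff.1 h).1
  · rintro ⟨s, t⟩ hst
    simp only [Finset.mem_filter, Finset.mem_product, Finset.mem_univ, true_and] at hst
    obtain ⟨⟨hs, ht⟩, h⟩ := hst
    obtain ⟨j, hj⟩ := Function.ne_iff.1 ht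
    have hj : t j ≠ 0 := hj
    have e : ∀ i l, s i * t l = u i * v l := fun i l => congrFun (congrFun h i) l
    have hsu : s = (v j / t j) • u := by
      ext i
      have := e i j
      simp only [Pi.smul_apply, smul_eq_mul]
      field_simp
      rw [this, mul_comm]
    have hc : v j / t j ≠ 0 := fun h0 => hs (by rw [hsu, h0, zero_smul])
    have hvj : v j ≠ 0 := fun h0 => hc (by rw [h0, zero_div])
    obtain ⟨i, hi⟩ := Function.ne_iff.1 hu
    have hi : u i ≠ 0 := hi
    refine ⟨v j / t j, by simpa using hc, ?_⟩
    refine Prod.ext hsu.symm ?_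
    ext l
    have h1 := e i l
    rw [hsu] at h1
    simp only [Pi.smul_apply, smul_eq_mul] at h1 ⊢
    field_simp at h1 ⊢
    rw [← h1]

end RankLemmas

/-! ### Additive characters and their sums over rank one matrices. -/

section Characters

set_option linter.unusedSectionVars false

variable {F : Type*} [Field F] [Fintype F] [DecidableEq F] {m n : Type*} [Fintype m] [Fintype n]
  [DecidableEq m] [DecidableEq n]

/-- A nonzero linear functional takes every value equally often. -/
theorem card_smul_sum_comp_linear {V R : Type*} [AddCommGroup V] [Module F V] [Fintype V]
    [AddCommGroup R] (L : V →ₗ[F] F) (hL : L ≠ 0) (f : F → R) :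
    Fintype.card F • ∑ v, f (L v) = Fintype.card V • ∑ c, f c := by
  obtain ⟨v₀, hv₀⟩ : ∃ v₀, L v₀ ≠ 0 := by
    by_contra! h
    exact hL (LinearMap.ext h)
  -- Translating `v` along `v₀` shifts `L v` by any prescribed `c`, so the sum may be averaged over
  -- all shifts.
  have h1 : ∀ c : F, ∑ v, f (L v) = ∑ v, f (L v + c) := by
    intro c
    rw [← Equiv.sum_comp (Equiv.addRight ((c / L v₀) • v₀)) fun v => f (L v)]
    refine Finset.sum_congr rfl fun v _ => ?_
    rw [Equiv.coe_addRight, map_add, map_smul, smul_eq_mul, div_mul_cancel₀ _ hv₀]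
  calc Fintype.card F • ∑ v, f (L v) = ∑ c : F, ∑ v, f (L v) := by
        rw [Finset.sum_const, Finset.card_univ]
    _ = ∑ c : F, ∑ v, f (L v + c) := Finset.sum_congr rfl fun c _ => h1 c
    _ = ∑ v, ∑ c : F, f (L v + c) := Finset.sum_comm
    _ = ∑ _v : V, ∑ c : F, f c := by
        refine Finset.sum_congr rfl fun v _ => ?_
        exact Equiv.sum_comp (Equiv.addLeft (L v)) f
    _ = _ := by rw [Finset.sum_const, Finset.card_univ]

theorem sum_addChar_comp_linear {V : Type*} [AddCommGroup V] [Module F V] [Fintype V]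
    {χ : AddChar F ℂ} (hχ : χ ≠ 1) (L : V →ₗ[F] F) (hL : L ≠ 0) : ∑ v, χ (L v) = 0 := by
  have h := card_smul_sum_comp_linear L hL fun c => χ c
  rw [AddChar.sum_eq_zero_of_ne_one hχ, smul_zero, nsmul_eq_mul, mul_eq_zero] at h
  exact h.resolve_left (Nat.cast_ne_zero.2 Fintype.card_ne_zero)

/-- The dot product with a fixed vector, as a linear functional. -/
def dotLin (a : n → F) : (n → F) →ₗ[F] F where
  toFun t := a ⬝ᵥ t
  map_add' := dotProduct_add a
  map_smul' c t := by simp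

theorem dotLin_ne_zero {a : n → F} (ha : a ≠ 0) : dotLin a ≠ 0 := by
  intro h
  refine ha (funext fun i => ?_)
  simpa [dotLin] using LinearMap.congr_fun h (Pi.single i 1)

theorem sum_addChar_dotProduct {χ : AddChar F ℂ} (hχ : χ ≠ 1) (a : n → F) :
    ∑ t : n → F, χ (a ⬝ᵥ t) = if a = 0 then (Fintype.card F : ℂ) ^ Fintype.card n else 0 := by
  split_ifs with h
  · subst h
    simp
  · exact sum_addChar_comp_linear hχ (dotLin a) (dotLin_ne_zero h)

theorem sum_addChar_dotProduct_ne_zero {χ : AddChar F ℂ} (hχ : χ ≠ 1) (a : n → F) :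
    ∑ t : n → F with t ≠ 0, χ (a ⬝ᵥ t) =
      (if a = 0 then (Fintype.card F : ℂ) ^ Fintype.card n else 0) - 1 := by
  rw [← sum_addChar_dotProduct hχ a, Finset.filter_ne', ← Finset.sum_erase_add _ _
    (Finset.mem_univ (0 : n → F)), dotProduct_zero, AddChar.map_zero_eq_one, add_sub_cancel_right]

/-- The standard symmetric bilinear form on matrices. -/
def pairing (A B : Matrix m n F) : F := ∑ i, A i ⬝ᵥ B i

theorem pairing_comm (A B : Matrix m n F) : pairing A B = pairing B A :=
  Finset.sum_congr rfl fun _ _ => dotProduct_comm _ _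

theorem pairing_add_right (A B C : Matrix m n F) :
    pairing A (B + C) = pairing A B + pairing A C := by
  rw [pairing, pairing, pairing, ← Finset.sum_add_distrib]
  exact Finset.sum_congr rfl fun i _ => dotProduct_add _ _ _

theorem pairing_smul_right (A B : Matrix m n F) (c : F) :
    pairing A (c • B) = c * pairing A B := by
  rw [pairing, pairing, Finset.mul_sum]
  refine Finset.sum_congr rfl fun i _ => ?_
  change A i ⬝ᵥ (c • B i) = _
  rw [dotProduct_smul, smul_eq_mul]

theorem pairing_smul_left (A B : Matrix m n F) (c : F) :
    pairing (c • A) B = c * pairing A B := by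
  rw [pairing_comm, pairing_smul_right, pairing_comm]

theorem pairing_neg_right (A B : Matrix m n F) : pairing A (-B) = -pairing A B := by
  rw [← neg_one_smul F B, pairing_smul_right, neg_one_mul]

theorem pairing_sub_right (A B C : Matrix m n F) :
    pairing A (B - C) = pairing A B - pairing A C := by
  rw [sub_eq_add_neg, pairing_add_right, pairing_neg_right, sub_eq_add_neg]

theorem pairing_sub_left (A B C : Matrix m n F) :
    pairing (A - B) C = pairing A C - pairing B C := by
  rw [pairing_comm, pairing_sub_right, pairing_comm C, pairing_comm C]

theorem pairing_vecMulVec_left (u : m → F) (v : n → F) (W : Matrix m n F) :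
    pairing (vecMulVec u v) W = (u ᵥ* W) ⬝ᵥ v := by
  rw [← dotProduct_mulVec, pairing, dotProduct]
  refine Finset.sum_congr rfl fun _ _ => ?_
  rw [mulVec, dotProduct, dotProduct, Finset.mul_sum]
  refine Finset.sum_congr rfl fun j _ => ?_
  rw [vecMulVec_apply]
  ring

/-- The pairing with a fixed matrix, as a linear functional. -/
def pairingLin (A : Matrix m n F) : Matrix m n F →ₗ[F] F where
  toFun := pairing A
  map_add' := pairing_add_right A
  map_smul' c B := pairing_smul_right A B c

theorem pairingLin_ne_zero {A : Matrix m n F} (hA : A ≠ 0) : pairingLin A ≠ 0 := by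
  intro h
  apply hA
  ext i j
  have := LinearMap.congr_fun h (vecMulVec (Pi.single i 1) (Pi.single j 1))
  simpa [pairingLin, pairing_comm A, pairing_vecMulVec_left] using this

theorem sum_addChar_pairing {χ : AddChar F ℂ} (hχ : χ ≠ 1) (A : Matrix m n F) :
    ∑ W : Matrix m n F, χ (pairing A W) =
      if A = 0 then (Fintype.card (Matrix m n F) : ℂ) else 0 := by
  split_ifs with h
  · subst h
    have : ∀ W : Matrix m n F, pairing 0 W = 0 := fun W => by
      rw [← zero_smul F (0 : Matrix m n F), pairing_smul_left, zero_mul]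
    simp [this]
  · exact sum_addChar_comp_linear hχ (pairingLin A) (pairingLin_ne_zero h)

theorem card_vecMul_eq_zero (W : Matrix m n F) :
    (Finset.univ.filter fun s : m → F => s ᵥ* W = 0).card =
      Fintype.card F ^ (Fintype.card m - W.rank) := by
  have e : (Finset.univ.filter fun s : m → F => s ᵥ* W = 0).card =
      Nat.card (LinearMap.ker Wᵀ.mulVecLin) := by
    rw [← Fintype.card_coe, ← Nat.card_eq_fintype_card]
    refine Nat.card_congr (Equiv.subtypeEquivRight fun s => ?_)
    simp [LinearMap.mem_ker]
  have h := LinearMap.finrank_range_add_finrank_ker Wᵀ.mulVecLin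
  have hr : Module.finrank F (LinearMap.range Wᵀ.mulVecLin) = W.rank := Matrix.rank_transpose W
  rw [hr, Module.finrank_fintype_fun_eq_card] at h
  rw [e, Module.natCard_eq_pow_finrank (K := F), Nat.card_eq_fintype_card]
  congr 1
  omega

/-- The eigenvalues of the bilinear forms graph on `m × n` matrices. -/
noncomputable def theta (F m n : Type*) [Fintype F] [Fintype m] [Fintype n] (r : ℕ) : ℝ :=
  ((Fintype.card F : ℝ) ^ Fintype.card n * (Fintype.card F : ℝ) ^ (Fintype.card m - r) -
    (Fintype.card F : ℝ) ^ Fintype.card n - (Fintype.card F : ℝ) ^ Fintype.card m + 1) /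
      ((Fintype.card F : ℝ) - 1)

/-- For fixed `s`, the sum over `t ≠ 0` is `q ^ n - 1` if `s` is in the left kernel of `W` and `-1`
otherwise. The left kernel has `q ^ (m - W.rank)` elements, and each rank one matrix arises from `q
- 1` pairs. -/
theorem sum_rank_one_addChar {χ : AddChar F ℂ} (hχ : χ ≠ 1) (W : Matrix m n F) :
    ∑ C : Matrix m n F with C.rank = 1, χ (pairing C W) = (theta F m n W.rank : ℂ) := by
  have hq : 1 < Fintype.card F := Fintype.one_lt_card
  have h := sum_rank_one fun C : Matrix m n F => χ (pairing C W)
  simp only [pairing_vecMulVec_left] at h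
  simp only [sum_addChar_dotProduct_ne_zero hχ] at h
  rw [Finset.sum_sub_distrib, Finset.sum_const, Finset.filter_ne', Finset.card_erase_of_mem
    (Finset.mem_univ _), Finset.card_univ, Fintype.card_fun,
    Finset.sum_erase_eq_sub (Finset.mem_univ _), ← Finset.sum_filter, Finset.sum_const,
    card_vecMul_eq_zero, zero_vecMul, if_pos rfl, nsmul_eq_mul, nsmul_eq_mul, nsmul_eq_mul,
    Nat.cast_sub hq.le, Nat.cast_sub (Nat.one_le_pow _ _ (by omega))] at h
  have hq1 : (Fintype.card F : ℂ) - 1 ≠ 0 := by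
    rw [sub_ne_zero]
    exact_mod_cast hq.ne'
  rw [theta]
  push_cast at h ⊢
  rw [eq_div_iff hq1, mul_comm, h]
  ring

/-- Transferring character sums between neighbours of rank one matrices. -/
theorem sum_common_neighbors_addChar {χ : AddChar F ℂ} (hχ : χ ≠ 1) {C Z : Matrix m n F}
    (hC : C.rank = 1) (hZ : Z.rank = 1) :
    ∑ C' : Matrix m n F with C'.rank = 1 ∧ (C' - C).rank = 1, χ (pairing C' Z) =
      ∑ Z' : Matrix m n F with Z'.rank = 1 ∧ (Z' - Z).rank = 1, χ (pairing Z' C) := by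
  obtain ⟨u, v, hu, hv, rfl⟩ := exists_eq_vecMulVec_of_rank_eq_one hC
  obtain ⟨s, t, hs, ht, rfl⟩ := exists_eq_vecMulVec_of_rank_eq_one hZ
  have row : ∀ {a b : m → F} {c : n → F}, c ≠ 0 →
      ∑ w : n → F with w ≠ 0, χ (pairing (vecMulVec a w) (vecMulVec b c)) =
        (if a ⬝ᵥ b = 0 then (Fintype.card F : ℂ) ^ Fintype.card n else 0) - 1 := by
    intro a b c hc
    simp only [pairing_vecMulVec_left, sum_addChar_dotProduct_ne_zero hχ, vecMul_vecMulVec,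
      smul_eq_zero, hc, or_false]
  have col : ∀ {b : m → F} {a c : n → F}, b ≠ 0 →
      ∑ w : m → F with w ≠ 0, χ (pairing (vecMulVec w a) (vecMulVec b c)) =
        (if c ⬝ᵥ a = 0 then (Fintype.card F : ℂ) ^ Fintype.card m else 0) - 1 := by
    intro b a c hb
    have e : ∀ w : m → F, pairing (vecMulVec w a) (vecMulVec b c) = ((c ⬝ᵥ a) • b) ⬝ᵥ w := by
      intro w
      rw [pairing_vecMulVec_left, vecMul_vecMulVec, smul_dotProduct, smul_dotProduct,
        smul_eq_mul, smul_eq_mul, mul_comm, dotProduct_comm w]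
    simp only [e, sum_addChar_dotProduct_ne_zero hχ, smul_eq_zero, hb, or_false]
  -- With `C = u ⊗ v` and `Z = s ⊗ t`, every term depends only on whether `u ⬝ᵥ s` or `v ⬝ᵥ t`
  -- vanishes, or on `pairing C Z`; all are symmetric in `C` and `Z`.
  rw [sum_common_neighbors _ hu hv, sum_common_neighbors _ hs ht, row ht, row hv, col hs, col hu]
  simp only [pairing_smul_left]
  rw [pairing_comm (vecMulVec u v), dotProduct_comm u s, dotProduct_comm t v]

end Characters

/-! ### Fourier analysis of the adjacency matrix and the triple product of the kernel. -/

section Spectrum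

set_option linter.unusedSectionVars false

variable {F : Type*} [Field F] [Fintype F] [DecidableEq F] {m n : Type*} [Fintype m] [Fintype n]
  [DecidableEq m] [DecidableEq n]

/-- The adjacency matrix of the bilinear forms graph. -/
noncomputable def rankOneMatrix (F m n : Type*) [Field F] [Fintype n] :
    Matrix (Matrix m n F) (Matrix m n F) ℝ :=
  fun z w => if (z - w).rank = 1 then 1 else 0

/-- The explicit form of the primitive idempotent. -/
noncomputable def thetaKernel (F m n : Type*) [Field F] [Fintype F] [DecidableEq F] [Fintype m]
    [Fintype n] [DecidableEq m] [DecidableEq n] : Matrix (Matrix m n F) (Matrix m n F) ℝ :=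
  fun z w => (Fintype.card (Matrix m n F) : ℝ)⁻¹ * theta F m n (z - w).rank

/-- The Fourier transform of a function on the vertices. -/
noncomputable def fourier (χ : AddChar F ℂ) (v : Matrix m n F → ℝ) (C : Matrix m n F) : ℂ :=
  ∑ z, (v z : ℂ) * χ (pairing C z)

theorem sum_fourier {χ : AddChar F ℂ} (hχ : χ ≠ 1) (v : Matrix m n F → ℝ) (z : Matrix m n F) :
    ∑ C, fourier χ v C * χ (-pairing C z) = Fintype.card (Matrix m n F) * v z := by
  simp only [fourier, Finset.sum_mul]
  rw [Finset.sum_comm]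
  have h : ∀ w : Matrix m n F, ∑ C : Matrix m n F, (v w : ℂ) * χ (pairing C w) * χ (-pairing C z) =
      if w = z then Fintype.card (Matrix m n F) * (v w : ℂ) else 0 := by
    intro w
    have := sum_addChar_pairing hχ (w - z)
    simp only [sub_eq_zero] at this
    rw [Finset.sum_congr rfl (g := fun C => (v w : ℂ) * χ (pairing (w - z) C)), ← Finset.mul_sum,
      this]
    · split_ifs <;> ring
    · intro C _
      rw [mul_assoc, ← AddChar.map_add_eq_mul, pairing_comm, pairing_comm C, pairing_sub_left,
        sub_eq_add_neg]
  rw [Finset.sum_congr rfl fun w _ => h w]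
  simp

/-- The adjacency matrix is convolution with the indicator of the rank one matrices, so it
multiplies each frequency by the corresponding character sum. -/
theorem fourier_adjacency {χ : AddChar F ℂ} (hχ : χ ≠ 1) (v : Matrix m n F → ℝ)
    (C : Matrix m n F) :
    fourier χ (rankOneMatrix F m n *ᵥ v) C = theta F m n C.rank * fourier χ v C := by
  simp only [fourier, mulVec, dotProduct, rankOneMatrix]
  push_cast
  simp only [Finset.sum_mul]
  rw [Finset.sum_comm, Finset.mul_sum]
  refine Finset.sum_congr rfl fun z _ => ?_
  rw [← sum_rank_one_addChar hχ, Finset.sum_filter, Finset.sum_mul,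
    ← Equiv.sum_comp (Equiv.subRight z) fun S =>
      (if S.rank = 1 then χ (pairing S C) else 0) * ((v z : ℂ) * χ (pairing C z))]
  refine Finset.sum_congr rfl fun w _ => ?_
  rw [Equiv.subRight_apply]
  split_ifs
  · rw [pairing_sub_left, Complex.ofReal_one, one_mul, pairing_comm w, pairing_comm z, mul_left_comm,
      ← AddChar.map_add_eq_mul, sub_add_cancel]
  · simp

/-- Self-duality: `theta` at the rank of `z - w` is itself a character sum over rank one matrices,
so the kernel is Fourier inversion restricted to frequencies of rank one. -/
theorem thetaKernel_mulVec {χ : AddChar F ℂ} (hχ : χ ≠ 1) (v : Matrix m n F → ℝ)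
    (z : Matrix m n F) :
    ((thetaKernel F m n *ᵥ v) z : ℂ) = (Fintype.card (Matrix m n F) : ℂ)⁻¹ *
      ∑ C : Matrix m n F with C.rank = 1, fourier χ v C * χ (-pairing C z) := by
  simp only [fourier, mulVec, dotProduct, thetaKernel]
  push_cast
  simp only [Finset.sum_mul]
  rw [Finset.sum_comm, Finset.mul_sum]
  refine Finset.sum_congr rfl fun w _ => ?_
  rw [rank_sub_comm, ← sum_rank_one_addChar hχ, mul_assoc, Finset.sum_mul]
  congr 1
  refine Finset.sum_congr rfl fun C _ => ?_
  rw [pairing_sub_right, sub_eq_add_neg, AddChar.map_add_eq_mul]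
  ring

theorem exists_addChar_ne_one (F : Type*) [Field F] [Fintype F] : ∃ χ : AddChar F ℂ, χ ≠ 1 := by
  obtain ⟨χ, hχ⟩ := (AddChar.exists_apply_ne_zero (α := F)).2 (one_ne_zero)
  exact ⟨χ, fun h => hχ (by rw [h, AddChar.one_apply])⟩

theorem theta_of_eigenvector {χ : AddChar F ℂ} (hχ : χ ≠ 1) {v : Matrix m n F → ℝ} {η : ℝ}
    (hv : rankOneMatrix F m n *ᵥ v = η • v) (C : Matrix m n F) :
    theta F m n C.rank = η ∨ fourier χ v C = 0 := by
  have h := fourier_adjacency hχ v C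
  have h' : fourier χ (η • v) C = η * fourier χ v C := by
    simp only [fourier, Finset.mul_sum, Pi.smul_apply, smul_eq_mul, Complex.ofReal_mul, mul_assoc]
  rw [hv, h'] at h
  rw [or_iff_not_imp_right]
  intro h0
  exact_mod_cast (mul_right_cancel₀ h0 h).symm

/-- The bound on `s` matters because the exponent is a truncated subtraction: beyond `Fintype.card
m` the function is constant. -/
theorem theta_lt_theta {r s : ℕ} (hrs : r < s) (hs : s ≤ Fintype.card m) :
    theta F m n s < theta F m n r := by
  have hq : (1 : ℝ) < Fintype.card F := by exact_mod_cast (Fintype.one_lt_card : 1 < Fintype.card F)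
  rw [theta, theta]
  have h1 : (Fintype.card F : ℝ) ^ (Fintype.card m - s) <
      (Fintype.card F : ℝ) ^ (Fintype.card m - r) := pow_lt_pow_right₀ hq (by omega)
  have h2 : (0 : ℝ) < (Fintype.card F : ℝ) ^ Fintype.card n := by positivity
  have := mul_lt_mul_of_pos_left h1 h2
  exact div_lt_div_of_pos_right (by linarith) (by linarith)

/-- The transform of an eigenvector lives on the `C` with `theta` of the rank of `C` equal to the
eigenvalue. By strict monotonicity, for `theta F m n 1` these are only matrices of rank one, the
frequencies that the kernel keeps. -/
theorem isPrimitiveIdempotent_thetaKernel (hm : 1 ≤ Fintype.card m) :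
    IsPrimitiveIdempotent (rankOneMatrix F m n) (theta F m n 1) (thetaKernel F m n) := by
  obtain ⟨χ, hχ⟩ := exists_addChar_ne_one F
  have rank_le : ∀ C : Matrix m n F, C.rank ≤ Fintype.card m := fun C => C.rank_le_card_height
  have hX : (Fintype.card (Matrix m n F) : ℂ) ≠ 0 := Nat.cast_ne_zero.2 Fintype.card_ne_zero
  constructor
  · intro v hv
    funext z
    have h := thetaKernel_mulVec hχ v z
    rw [Finset.sum_filter_of_ne, sum_fourier hχ, inv_mul_cancel_left₀ hX] at h
    · exact_mod_cast h
    · intro C _ hC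
      rcases theta_of_eigenvector hχ hv C with h | h
      · by_contra hne
        rcases lt_or_gt_of_ne hne with hlt | hlt
        · exact (theta_lt_theta (F := F) (n := n) hlt hm).ne' h
        · exact (theta_lt_theta (F := F) (n := n) hlt (rank_le C)).ne h
      · rw [h, zero_mul] at hC
        exact absurd rfl hC
  · intro η hη v hv
    funext z
    have h := thetaKernel_mulVec hχ v z
    rw [Finset.sum_eq_zero, mul_zero] at h
    · exact_mod_cast h
    · intro C hC
      rcases theta_of_eigenvector hχ hv C with h | h
      · rw [(Finset.mem_filter.1 hC).2] at h
        exact absurd h.symm hη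
      · rw [h, zero_mul]

/-- The real part of a character is an eigenvector. -/
theorem rankOneMatrix_mulVec_re {χ : AddChar F ℂ} (hχ : χ ≠ 1) (C : Matrix m n F) :
    rankOneMatrix F m n *ᵥ (fun z => (χ (pairing C z)).re) =
      theta F m n C.rank • fun z => (χ (pairing C z)).re := by
  funext z
  have h : ∑ w, (rankOneMatrix F m n z w : ℂ) * χ (pairing C w) =
      (theta F m n C.rank : ℂ) * χ (pairing C z) := by
    rw [← sum_rank_one_addChar hχ, Finset.sum_filter, Finset.sum_mul,
      ← Equiv.sum_comp (Equiv.subRight z) fun S =>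
        (if S.rank = 1 then χ (pairing S C) else 0) * χ (pairing C z)]
    refine Finset.sum_congr rfl fun w _ => ?_
    rw [Equiv.subRight_apply, rankOneMatrix, rank_sub_comm z w]
    split_ifs
    · rw [pairing_comm (w - z), ← AddChar.map_add_eq_mul, ← pairing_add_right, sub_add_cancel,
        Complex.ofReal_one, one_mul]
    · simp
  have h' := congrArg Complex.re h
  rw [Complex.re_sum, Complex.re_ofReal_mul] at h'
  simp only [Complex.re_ofReal_mul] at h'
  exact h'

theorem mem_eigenvalueSet_iff {X : Type*} [Fintype X] [DecidableEq X] {A : Matrix X X ℝ} {η : ℝ} :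
    η ∈ eigenvalueSet A ↔ ∃ v : X → ℝ, v ≠ 0 ∧ A *ᵥ v = η • v := by
  rw [eigenvalueSet, Set.mem_ofPred_eq, ← Matrix.minpoly_toLin',
    ← Module.End.hasEigenvalue_iff_isRoot]
  constructor
  · intro h
    obtain ⟨v, hv⟩ := h.exists_hasEigenvector
    exact ⟨v, hv.2, by simpa using hv.apply_eq_smul⟩
  · rintro ⟨v, hv, h⟩
    exact Module.End.hasEigenvalue_of_hasEigenvector
      (Module.End.hasEigenvector_iff.2 ⟨Module.End.mem_eigenspace_iff.2 (by simpa using h), hv⟩)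

theorem theta_rank_mem_eigenvalueSet (C : Matrix m n F) :
    theta F m n C.rank ∈ eigenvalueSet (rankOneMatrix F m n) := by
  obtain ⟨χ, hχ⟩ := exists_addChar_ne_one F
  refine mem_eigenvalueSet_iff.2 ⟨_, fun h => ?_, rankOneMatrix_mulVec_re hχ C⟩
  -- A character is `1` at the origin, so its real part is not the zero function.
  have h0 := congrFun h 0
  have : pairing C (0 : Matrix m n F) = 0 := by
    rw [← zero_smul F (0 : Matrix m n F), pairing_smul_right, zero_mul]
  simp [this] at h0

theorem exists_rank_of_mem_eigenvalueSet {η : ℝ} (h : η ∈ eigenvalueSet (rankOneMatrix F m n)) :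
    ∃ C : Matrix m n F, theta F m n C.rank = η := by
  obtain ⟨χ, hχ⟩ := exists_addChar_ne_one F
  obtain ⟨v, hv0, hv⟩ := mem_eigenvalueSet_iff.1 h
  by_contra! hC
  apply hv0
  funext z
  have := sum_fourier hχ v z
  rw [Finset.sum_eq_zero] at this
  · rcases mul_eq_zero.1 this.symm with h | h
    · exact absurd h (Nat.cast_ne_zero.2 Fintype.card_ne_zero)
    · exact_mod_cast h
  · intro C _
    rw [(theta_of_eigenvector hχ hv C).resolve_left (hC C), zero_mul]

theorem secondLargestEigenvalue_rankOneMatrix [Nonempty m] [Nonempty n] :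
    secondLargestEigenvalue (rankOneMatrix F m n) = theta F m n 1 := by
  have rank_le : ∀ C : Matrix m n F, C.rank ≤ Fintype.card m := fun C => C.rank_le_card_height
  have top : IsGreatest (eigenvalueSet (rankOneMatrix F m n)) (theta F m n 0) := by
    refine ⟨by simpa using theta_rank_mem_eigenvalueSet (0 : Matrix m n F), fun η hη => ?_⟩
    obtain ⟨C, rfl⟩ := exists_rank_of_mem_eigenvalueSet hη
    rcases Nat.eq_zero_or_pos C.rank with h | h
    · rw [h]
    · exact (theta_lt_theta h (rank_le C)).le
  rw [secondLargestEigenvalue, top.csSup_eq]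
  refine IsGreatest.csSup_eq ⟨⟨?_, theta_lt_theta one_pos Fintype.card_pos⟩, ?_⟩
  · have h := theta_rank_mem_eigenvalueSet (vecMulVec (1 : m → F) (1 : n → F))
    rwa [rank_vecMulVec_eq_one one_ne_zero one_ne_zero] at h
  · rintro η ⟨hη, hlt⟩
    obtain ⟨C, rfl⟩ := exists_rank_of_mem_eigenvalueSet hη
    rcases lt_trichotomy C.rank 1 with h | h | h
    · rw [Nat.lt_one_iff.1 h] at hlt
      exact absurd hlt (lt_irrefl _)
    · rw [h]
    · exact (theta_lt_theta h (rank_le C)).le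

theorem sum_theta_mul_addChar {χ : AddChar F ℂ} (hχ : χ ≠ 1) (p C : Matrix m n F) :
    ∑ w : Matrix m n F, (theta F m n (p - w).rank : ℂ) * χ (pairing C w) =
      if C.rank = 1 then Fintype.card (Matrix m n F) * χ (pairing C p) else 0 := by
  simp only [← sum_rank_one_addChar hχ, Finset.sum_mul, Finset.sum_filter]
  rw [Finset.sum_comm]
  have h : ∀ S : Matrix m n F,
      ∑ w : Matrix m n F, (if S.rank = 1 then χ (pairing S (p - w)) else 0) * χ (pairing C w) =
        if S = C then (if S.rank = 1 then
          Fintype.card (Matrix m n F) * χ (pairing C p) else 0) else 0 := by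
    intro S
    have h' : ∀ w, χ (pairing S (p - w)) * χ (pairing C w) =
        χ (pairing S p) * χ (pairing (C - S) w) := by
      intro w
      rw [← AddChar.map_add_eq_mul, ← AddChar.map_add_eq_mul, pairing_sub_left, pairing_sub_right]
      congr 1
      ring
    by_cases h1 : S.rank = 1
    · simp only [if_pos h1, h', ← Finset.mul_sum, sum_addChar_pairing hχ]
      by_cases h2 : S = C
      · rw [h2, sub_self, if_pos rfl, if_pos rfl, mul_comm]
      · rw [if_neg (fun h0 => h2 (sub_eq_zero.1 h0).symm), mul_zero, if_neg h2]
    · simp [h1]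
  rw [Finset.sum_congr rfl fun S _ => h S]
  simp

/-- This is the Norton product of adjacent vertices in coordinates, with the factors `|X|⁻¹`
cleared. -/
theorem sum_theta_triple (p x z : Matrix m n F) (hxz : (z - x).rank = 1) :
    ∑ w : Matrix m n F, theta F m n (p - w).rank * (theta F m n (w - x).rank *
        theta F m n (w - z).rank) =
      Fintype.card (Matrix m n F) *
        ∑ w : Matrix m n F with (w - x).rank = 1 ∧ (w - z).rank = 1, theta F m n (p - w).rank := by
  obtain ⟨χ, hχ⟩ := exists_addChar_ne_one F
  have lhs : ∑ w : Matrix m n F, (theta F m n (p - w).rank : ℂ) * ((theta F m n (w - x).rank : ℂ) *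
        (theta F m n (w - z).rank : ℂ)) = Fintype.card (Matrix m n F) *
      ∑ C : Matrix m n F with C.rank = 1, χ (pairing C (p - x)) *
        ∑ S : Matrix m n F with S.rank = 1 ∧ (S - C).rank = 1, χ (pairing S (x - z)) := by
    -- The two rank one frequencies are regrouped as `S` and `C - S`. Then `w` enters only through
    -- `χ (pairing C w)`, and summing against `theta` selects the `C` of rank one.
    have h1 : ∀ w : Matrix m n F, (theta F m n (w - x).rank : ℂ) * (theta F m n (w - z).rank : ℂ) =
        ∑ C : Matrix m n F, ∑ S : Matrix m n F, if S.rank = 1 ∧ (S - C).rank = 1 then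
          χ (pairing S (x - z)) * χ (-pairing C x) * χ (pairing C w) else 0 := by
      intro w
      rw [← sum_rank_one_addChar hχ, ← sum_rank_one_addChar hχ, mul_comm, Finset.sum_mul_sum,
        Finset.sum_filter, Finset.sum_comm]
      refine Finset.sum_congr rfl fun S _ => ?_
      rw [Finset.sum_filter, ← Equiv.sum_comp (Equiv.subRight S)]
      by_cases hS : S.rank = 1
      · rw [if_pos hS]
        refine Finset.sum_congr rfl fun C _ => ?_
        rw [Equiv.subRight_apply, rank_sub_comm C S]
        by_cases hCS : (S - C).rank = 1
        · rw [if_pos hCS, if_pos ⟨hS, hCS⟩, ← AddChar.map_add_eq_mul, ← AddChar.map_add_eq_mul,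
            ← AddChar.map_add_eq_mul]
          congr 1
          simp only [pairing_sub_left, pairing_sub_right]
          ring
        · rw [if_neg hCS, if_neg fun h => hCS h.2]
      · rw [if_neg hS]
        simp [hS]
    simp only [h1, Finset.mul_sum]
    rw [Finset.sum_comm, Finset.sum_filter]
    refine Finset.sum_congr rfl fun C _ => ?_
    rw [Finset.sum_comm]
    have h2 : ∀ S : Matrix m n F, (∑ w : Matrix m n F, (theta F m n (p - w).rank : ℂ) *
        if S.rank = 1 ∧ (S - C).rank = 1 then
          χ (pairing S (x - z)) * χ (-pairing C x) * χ (pairing C w) else 0) =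
        if C.rank = 1 then (if S.rank = 1 ∧ (S - C).rank = 1 then
          (Fintype.card (Matrix m n F) : ℂ) *
            (χ (pairing C (p - x)) * χ (pairing S (x - z))) else 0) else 0 := by
      intro S
      by_cases hS : S.rank = 1 ∧ (S - C).rank = 1
      · simp only [if_pos hS, mul_left_comm _ (χ (pairing S (x - z)) * χ (-pairing C x)),
          ← Finset.mul_sum, sum_theta_mul_addChar hχ, mul_ite, mul_zero]
        split_ifs
        · rw [pairing_sub_right C, sub_eq_add_neg (pairing C p), AddChar.map_add_eq_mul]
          ring
        · rfl
      · simp [if_neg hS]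
    rw [Finset.sum_congr rfl fun S _ => h2 S]
    split_ifs
    · rw [Finset.sum_filter]
    · simp
  have rhs : ∑ w : Matrix m n F with (w - x).rank = 1 ∧ (w - z).rank = 1,
      (theta F m n (p - w).rank : ℂ) =
      ∑ C : Matrix m n F with C.rank = 1, χ (pairing C (p - x)) *
        ∑ S : Matrix m n F with S.rank = 1 ∧ (S - (x - z)).rank = 1, χ (pairing S C) := by
    simp only [← sum_rank_one_addChar hχ]
    rw [Finset.sum_comm]
    refine Finset.sum_congr rfl fun C _ => ?_
    rw [Finset.mul_sum, Finset.sum_filter, Finset.sum_filter,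
      ← Equiv.sum_comp (Equiv.subLeft x)]
    refine Finset.sum_congr rfl fun w _ => ?_
    rw [Equiv.subLeft_apply, sub_sub_cancel_left, rank_neg, sub_right_comm, rank_sub_comm _ w]
    split_ifs
    · rw [← AddChar.map_add_eq_mul, pairing_comm _ C, ← pairing_add_right, sub_sub_eq_add_sub,
        sub_add_eq_add_sub]
    · rfl
  have hZ : (x - z).rank = 1 := by rw [rank_sub_comm, hxz]
  have key : (((∑ w : Matrix m n F, theta F m n (p - w).rank * (theta F m n (w - x).rank *
      theta F m n (w - z).rank) : ℝ)) : ℂ) = ((Fintype.card (Matrix m n F) *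
        ∑ w : Matrix m n F with (w - x).rank = 1 ∧ (w - z).rank = 1,
          theta F m n (p - w).rank : ℝ) : ℂ) := by
    push_cast
    rw [lhs, rhs]
    congr 1
    refine Finset.sum_congr rfl fun C hC => ?_
    -- Reciprocity exchanges the frequency `C` with the difference `x - z`.
    rw [sum_common_neighbors_addChar hχ (Finset.mem_filter.1 hC).2 hZ]
  exact_mod_cast key

end Spectrum

/-! ### Rank one perturbations of a fixed matrix and weights determined by them. -/

section Profile

set_option linter.unusedSectionVars false

variable {F : Type*} [Field F] [DecidableEq F] {m n : Type*} [Fintype m] [Fintype n]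
  [DecidableEq m] [DecidableEq n]

/-- Some `x` is killed by `Y` but not by `t`. The perturbed matrix sends it to a nonzero multiple of
`s`, so `s` is in the new range, and adding multiples of `s` recovers the old one. -/
theorem range_le_range_sub_vecMulVec {Y : Matrix m n F} {s : m → F} {t : n → F}
    (ht : t ∉ LinearMap.range Yᵀ.mulVecLin) :
    s ∈ LinearMap.range (Y - vecMulVec s t).mulVecLin ∧
      LinearMap.range Y.mulVecLin ≤ LinearMap.range (Y - vecMulVec s t).mulVecLin := by
  have app : ∀ v, (Y - vecMulVec s t).mulVecLin v = Y *ᵥ v - (t ⬝ᵥ v) • s := by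
    intro v
    rw [mulVecLin_apply, sub_mulVec, vecMulVec_mulVec]
    simp
  obtain ⟨x, hx, hx'⟩ := exists_dotProduct_ne_zero ht
  have hYx : Y *ᵥ x = 0 := by
    funext i
    have := hx' (Y i) ⟨Pi.single i 1, by
      ext j
      simp⟩
    exact this
  have hs : s ∈ LinearMap.range (Y - vecMulVec s t).mulVecLin := by
    refine ⟨-(t ⬝ᵥ x)⁻¹ • x, ?_⟩
    rw [map_smul, app, hYx, zero_sub, neg_smul_neg, smul_smul, inv_mul_cancel₀ hx, one_smul]
  refine ⟨hs, ?_⟩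
  rintro _ ⟨v, rfl⟩
  have e : Y.mulVecLin v = (Y - vecMulVec s t).mulVecLin v + (t ⬝ᵥ v) • s := by
    rw [app, sub_add_cancel, mulVecLin_apply]
  rw [e]
  exact add_mem ⟨v, rfl⟩ (Submodule.smul_mem _ _ hs)

theorem rank_sub_vecMulVec_of_mem_left {Y : Matrix m n F} {s : m → F} {t : n → F}
    (hs : s ∈ LinearMap.range Y.mulVecLin) (ht : t ∉ LinearMap.range Yᵀ.mulVecLin) :
    (Y - vecMulVec s t).rank = Y.rank := by
  refine le_antisymm (Submodule.finrank_mono ?_)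
    (Submodule.finrank_mono (range_le_range_sub_vecMulVec ht).2)
  rintro _ ⟨v, rfl⟩
  rw [mulVecLin_apply, sub_mulVec, vecMulVec_mulVec, op_smul_eq_smul]
  exact sub_mem ⟨v, rfl⟩ (Submodule.smul_mem _ _ hs)

theorem rank_sub_vecMulVec_of_mem_right {Y : Matrix m n F} {s : m → F} {t : n → F}
    (hs : s ∉ LinearMap.range Y.mulVecLin) (ht : t ∈ LinearMap.range Yᵀ.mulVecLin) :
    (Y - vecMulVec s t).rank = Y.rank := by
  rw [← rank_transpose, ← rank_transpose Y, transpose_sub, transpose_vecMulVec]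
  exact rank_sub_vecMulVec_of_mem_left ht (by rwa [transpose_transpose])

theorem rank_sub_vecMulVec_of_notMem {Y : Matrix m n F} {s : m → F} {t : n → F}
    (hs : s ∉ LinearMap.range Y.mulVecLin) (ht : t ∉ LinearMap.range Yᵀ.mulVecLin) :
    (Y - vecMulVec s t).rank = Y.rank + 1 := by
  obtain ⟨h1, h2⟩ := range_le_range_sub_vecMulVec (s := s) ht
  refine le_antisymm ?_ (Submodule.finrank_lt_finrank_of_lt
    (lt_of_le_of_ne h2 fun h => hs (h ▸ h1)))
  have h := rank_add_le Y (-vecMulVec s t)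
  rw [rank_neg, ← sub_eq_add_neg] at h
  have := rank_vecMulVec_le s t
  omega

/-- A full rank factorization `Y = P * Q`, with one-sided inverses of the factors. -/
structure RankFactorization (Y : Matrix m n F) (k : ℕ) where
  P : Matrix m (Fin k) F
  Q : Matrix (Fin k) n F
  P' : Matrix (Fin k) m F
  Q' : Matrix n (Fin k) F
  eq_mul : Y = P * Q
  left_inv : P' * P = 1
  right_inv : Q * Q' = 1

namespace RankFactorization

variable {Y : Matrix m n F} {k : ℕ}

/-- The factorization of the transpose. -/
def transpose (R : RankFactorization Y k) : RankFactorization Yᵀ k where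
  P := R.Qᵀ
  Q := R.Pᵀ
  P' := R.Q'ᵀ
  Q' := R.P'ᵀ
  eq_mul := by rw [← Matrix.transpose_mul, ← R.eq_mul]
  left_inv := by rw [← Matrix.transpose_mul, R.right_inv, transpose_one]
  right_inv := by rw [← Matrix.transpose_mul, R.left_inv, transpose_one]

theorem mem_range_iff (R : RankFactorization Y k) {s : m → F} :
    s ∈ LinearMap.range Y.mulVecLin ↔ ∃ a, R.P *ᵥ a = s := by
  constructor
  · rintro ⟨v, rfl⟩
    exact ⟨R.Q *ᵥ v, by rw [mulVec_mulVec, ← R.eq_mul, mulVecLin_apply]⟩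
  · rintro ⟨a, rfl⟩
    exact ⟨R.Q' *ᵥ a, (congrArg (fun A => A *ᵥ (R.Q' *ᵥ a)) R.eq_mul).trans (by
      rw [mulVec_mulVec, Matrix.mul_assoc, R.right_inv, Matrix.mul_one])⟩

theorem rank_mul_mul (R : RankFactorization Y k) (B : Matrix (Fin k) (Fin k) F) :
    (R.P * B * R.Q).rank = B.rank := by
  apply le_antisymm
  · exact (rank_mul_le_left _ _).trans (rank_mul_le_right _ _)
  · have : B = R.P' * (R.P * B * R.Q) * R.Q' := by
      rw [Matrix.mul_assoc, Matrix.mul_assoc, Matrix.mul_assoc, R.right_inv, Matrix.mul_one,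
        ← Matrix.mul_assoc, R.left_inv, Matrix.one_mul]
    conv_lhs => rw [this]
    exact (rank_mul_le_left _ _).trans (rank_mul_le_right _ _)

theorem rank_eq (R : RankFactorization Y k) : Y.rank = k := by
  have := R.rank_mul_mul 1
  rwa [Matrix.mul_one, ← R.eq_mul, rank_one, Fintype.card_fin] at this

/-- The bilinear form attached to the factorization. -/
def form (R : RankFactorization Y k) (s : m → F) (t : n → F) : F := (R.P' *ᵥ s) ⬝ᵥ (R.Q'ᵀ *ᵥ t)

theorem form_transpose (R : RankFactorization Y k) (s : m → F) (t : n → F) :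
    R.transpose.form t s = R.form s t := by
  rw [form, form, dotProduct_comm]
  rfl

theorem form_smul_left (R : RankFactorization Y k) (c : F) (s : m → F) (t : n → F) :
    R.form (c • s) t = c * R.form s t := by
  rw [form, mulVec_smul, smul_dotProduct, smul_eq_mul, form]

theorem form_zero_right (R : RankFactorization Y k) (s : m → F) : R.form s 0 = 0 := by
  rw [form, mulVec_zero, dotProduct_zero]

/-- On the column and row spaces the form does not depend on the chosen one-sided inverses; `weight`
consults it only there. -/
theorem form_mulVec_mulVec (R : RankFactorization Y k) (a b : Fin k → F) :
    R.form (R.P *ᵥ a) (R.Qᵀ *ᵥ b) = a ⬝ᵥ b := by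
  rw [form, mulVec_mulVec, mulVec_mulVec, R.left_inv, ← transpose_mul, R.right_inv, transpose_one,
    one_mulVec, one_mulVec]

/-- The determinant is `1 - a ⬝ᵥ b`, and a rank one perturbation of the identity loses at most one
in rank. -/
theorem rank_one_sub_vecMulVec (a b : Fin k → F) :
    ((1 : Matrix (Fin k) (Fin k) F) - vecMulVec a b).rank =
      if a ⬝ᵥ b = 1 then k - 1 else k := by
  have hdet : ((1 : Matrix (Fin k) (Fin k) F) - vecMulVec a b).det = 1 - a ⬝ᵥ b := by
    have := det_one_add_replicateCol_mul_replicateRow (ι := Unit) (-a) b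
    rw [← vecMulVec_eq, neg_vecMulVec, ← sub_eq_add_neg] at this
    rw [this, dotProduct_neg, dotProduct_comm, sub_eq_add_neg]
  split_ifs with h
  · have h1 : ((1 : Matrix (Fin k) (Fin k) F) - vecMulVec a b).rank ≠ k := by
      intro hr
      have hsurj : Function.Surjective ((1 : Matrix (Fin k) (Fin k) F) - vecMulVec a b).mulVec := by
        have : LinearMap.range ((1 : Matrix (Fin k) (Fin k) F) - vecMulVec a b).mulVecLin = ⊤ := by
          apply Submodule.eq_top_of_finrank_eq
          rw [Module.finrank_fin_fun]
          exact hr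
        exact LinearMap.range_eq_top.1 this
      have := (Matrix.isUnit_iff_isUnit_det _).1 (Matrix.mulVec_surjective_iff_isUnit.1 hsurj)
      rw [hdet, h, sub_self] at this
      exact not_isUnit_zero this
    have h2 := rank_add_le ((1 : Matrix (Fin k) (Fin k) F) - vecMulVec a b) (vecMulVec a b)
    have h3 := rank_vecMulVec_le a b
    have h4 := rank_le_width ((1 : Matrix (Fin k) (Fin k) F) - vecMulVec a b)
    rw [sub_add_cancel, rank_one, Fintype.card_fin] at h2
    omega
  · rw [rank_of_det_ne_zero, Fintype.card_fin]
    rw [hdet, sub_ne_zero]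
    exact Ne.symm h

theorem rank_sub_vecMulVec (R : RankFactorization Y k) {s : m → F} {t : n → F}
    (hs : s ∈ LinearMap.range Y.mulVecLin) (ht : t ∈ LinearMap.range Yᵀ.mulVecLin) :
    (Y - vecMulVec s t).rank = if R.form s t = 1 then k - 1 else k := by
  obtain ⟨a, rfl⟩ := R.mem_range_iff.1 hs
  obtain ⟨b, rfl⟩ := R.transpose.mem_range_iff.1 ht
  change (Y - vecMulVec (R.P *ᵥ a) (R.Qᵀ *ᵥ b)).rank =
    if R.form (R.P *ᵥ a) (R.Qᵀ *ᵥ b) = 1 then k - 1 else k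
  rw [R.form_mulVec_mulVec, ← rank_one_sub_vecMulVec, ← R.rank_mul_mul, Matrix.mul_sub,
    Matrix.sub_mul, Matrix.mul_one, ← R.eq_mul, mulVec_transpose, mul_vecMulVec, vecMulVec_mul]

open Classical in
/-- A weight on pairs of vectors that depends only on the position relative to the column space
and the row space, and on the value of the bilinear form. -/
noncomputable def weight (R : RankFactorization Y k) (φ : F → ℝ) (p r w : ℝ) (s : m → F)
    (t : n → F) : ℝ :=
  if s ∈ LinearMap.range Y.mulVecLin then
    if t ∈ LinearMap.range Yᵀ.mulVecLin then φ (R.form s t) else p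
  else if t ∈ LinearMap.range Yᵀ.mulVecLin then r else w

theorem weight_transpose (R : RankFactorization Y k) (φ : F → ℝ) (p r w : ℝ) (s : m → F)
    (t : n → F) : R.transpose.weight φ r p w t s = R.weight φ p r w s t := by
  rw [weight, weight, form_transpose, transpose_transpose]
  split_ifs <;> rfl

variable [Fintype F]

open Classical in
theorem sum_mem_range (R : RankFactorization Y k) (f : (m → F) → ℝ) (c : ℝ) :
    (∑ s : m → F, if s ∈ LinearMap.range Y.mulVecLin then f s else c) =
      ∑ a : Fin k → F, f (R.P *ᵥ a) +
        ((Fintype.card F : ℝ) ^ Fintype.card m - (Fintype.card F : ℝ) ^ k) * c := by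
  have inj : Function.Injective fun a : Fin k → F => R.P *ᵥ a := by
    intro a b h
    have := congrArg (fun v => R.P' *ᵥ v) h
    simpa [mulVec_mulVec, R.left_inv] using this
  have himg : Finset.univ.filter (fun s : m → F => s ∈ LinearMap.range Y.mulVecLin) =
      Finset.univ.image fun a : Fin k → F => R.P *ᵥ a := by
    ext s
    rw [Finset.mem_filter, R.mem_range_iff]
    simp
  have hsplit : (∑ s : m → F, if s ∈ LinearMap.range Y.mulVecLin then f s else c) =
      ∑ s : m → F with s ∈ LinearMap.range Y.mulVecLin, (f s - c) + ∑ _s : m → F, c := by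
    rw [Finset.sum_filter, ← Finset.sum_add_distrib]
    refine Finset.sum_congr rfl fun s _ => ?_
    split_ifs <;> ring
  rw [hsplit, himg, Finset.sum_image inj.injOn, Finset.sum_sub_distrib, Finset.sum_const,
    Finset.sum_const, Finset.card_univ, Finset.card_univ, Fintype.card_fun, Fintype.card_fun,
    nsmul_eq_mul, nsmul_eq_mul, Fintype.card_fin]
  push_cast
  ring

/-- A nonzero functional on a space of dimension `k = j + 1` takes each value `q ^ (k - 1)` times.
-/
theorem sum_dotProduct {j : ℕ} {a : Fin (j + 1) → F} (ha : a ≠ 0) (φ : F → ℝ) :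
    ∑ b : Fin (j + 1) → F, φ (a ⬝ᵥ b) = (Fintype.card F : ℝ) ^ j * ∑ c, φ c := by
  have h : Fintype.card F • ∑ b : Fin (j + 1) → F, φ (a ⬝ᵥ b) = _ :=
    card_smul_sum_comp_linear (dotLin a) (dotLin_ne_zero ha) φ
  have hq : (Fintype.card F : ℝ) ≠ 0 := Nat.cast_ne_zero.2 Fintype.card_ne_zero
  rw [Fintype.card_fun, Fintype.card_fin, nsmul_eq_mul, nsmul_eq_mul, pow_succ'] at h
  push_cast at h
  rw [mul_assoc] at h
  exact mul_left_cancel₀ hq h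

open Classical in
-- For `t` in the row space, the form is equidistributed as `s` runs over the column space. The
-- final `φ 0` or `p` is the contribution of `s = 0`, which lies in the column space.
theorem sum_weight_left {j : ℕ} (R : RankFactorization Y (j + 1)) (φ : F → ℝ) (p r w : ℝ)
    {t : n → F} (ht : t ≠ 0) :
    ∑ s : m → F with s ≠ 0, R.weight φ p r w s t =
      if t ∈ LinearMap.range Yᵀ.mulVecLin then
        (Fintype.card F : ℝ) ^ j * (∑ c, φ c) +
          ((Fintype.card F : ℝ) ^ Fintype.card m - (Fintype.card F : ℝ) ^ (j + 1)) * r - φ 0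
      else (Fintype.card F : ℝ) ^ (j + 1) * p +
          ((Fintype.card F : ℝ) ^ Fintype.card m - (Fintype.card F : ℝ) ^ (j + 1)) * w - p := by
  rw [Finset.filter_ne', Finset.sum_erase_eq_sub (Finset.mem_univ _)]
  have h0 : (0 : m → F) ∈ LinearMap.range Y.mulVecLin := zero_mem _
  have hf : R.form 0 t = 0 := by rw [← R.form_transpose, form_zero_right]
  simp only [weight, if_pos h0, hf]
  rw [R.sum_mem_range]
  by_cases h : t ∈ LinearMap.range Yᵀ.mulVecLin
  · obtain ⟨b, rfl⟩ := R.transpose.mem_range_iff.1 h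
    have hb : b ≠ 0 := by
      rintro rfl
      exact ht (mulVec_zero _)
    simp only [if_pos h]
    have e : ∀ a, R.form (R.P *ᵥ a) (R.transpose.P *ᵥ b) = b ⬝ᵥ a := fun a => by
      rw [dotProduct_comm]
      exact R.form_mulVec_mulVec a b
    simp only [e, sum_dotProduct hb]
  · simp only [if_neg h]
    rw [Finset.sum_const, Finset.card_univ, Fintype.card_fun, Fintype.card_fin, nsmul_eq_mul]
    push_cast
    ring

open Classical in
theorem sum_weight_right {j : ℕ} (R : RankFactorization Y (j + 1)) (φ : F → ℝ) (p r w : ℝ)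
    {s : m → F} (hs : s ≠ 0) :
    ∑ t : n → F with t ≠ 0, R.weight φ p r w s t =
      if s ∈ LinearMap.range Y.mulVecLin then
        (Fintype.card F : ℝ) ^ j * (∑ c, φ c) +
          ((Fintype.card F : ℝ) ^ Fintype.card n - (Fintype.card F : ℝ) ^ (j + 1)) * p - φ 0
      else (Fintype.card F : ℝ) ^ (j + 1) * r +
          ((Fintype.card F : ℝ) ^ Fintype.card n - (Fintype.card F : ℝ) ^ (j + 1)) * w - r := by
  have := R.transpose.sum_weight_left φ r p w hs
  simp only [weight_transpose] at this
  rw [this, transpose_transpose]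

open Classical in
-- Scaling preserves membership in both spaces. A nonzero value of the form runs through all nonzero
-- scalars; otherwise the weight is constant along the multiples.
theorem sum_weight_smul (R : RankFactorization Y k) (φ : F → ℝ) (p r w : ℝ)
    (s : m → F) (t : n → F) :
    ∑ c : F with c ≠ 0, R.weight φ p r w (c • s) t =
      if s ∈ LinearMap.range Y.mulVecLin ∧ t ∈ LinearMap.range Yᵀ.mulVecLin ∧ R.form s t ≠ 0 then
        (∑ c, φ c) - φ 0
      else ((Fintype.card F : ℝ) - 1) * R.weight φ p r w s t := by
  have hmem : ∀ c : F, c ≠ 0 → (c • s ∈ LinearMap.range Y.mulVecLin ↔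
      s ∈ LinearMap.range Y.mulVecLin) := fun c hc => Submodule.smul_mem_iff _ hc
  split_ifs with h
  · obtain ⟨hs, ht, h0⟩ := h
    rw [← Finset.sum_erase_eq_sub (Finset.mem_univ (0 : F)), ← Finset.filter_ne']
    refine Finset.sum_bij (fun c _ => c * R.form s t) ?_ ?_ ?_ ?_
    · intro c hc
      simp only [Finset.mem_filter, Finset.mem_univ, true_and] at hc ⊢
      exact mul_ne_zero hc h0
    · intro c _ c' _ h
      exact mul_right_cancel₀ h0 h
    · intro c hc
      simp only [Finset.mem_filter, Finset.mem_univ, true_and] at hc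
      exact ⟨c / R.form s t, by simpa using ⟨hc, h0⟩, div_mul_cancel₀ _ h0⟩
    · intro c hc
      rw [weight, if_pos (Submodule.smul_mem _ _ hs), if_pos ht, form_smul_left]
  · have hcard : ((Fintype.card F : ℝ) - 1) = (Finset.univ.filter fun c : F => c ≠ 0).card := by
      rw [Finset.filter_ne', Finset.card_erase_of_mem (Finset.mem_univ _), Finset.card_univ,
        Nat.cast_sub Fintype.card_pos, Nat.cast_one]
    rw [hcard, ← nsmul_eq_mul, ← Finset.sum_const]
    refine Finset.sum_congr rfl fun c hc => ?_
    have hc : c ≠ 0 := (Finset.mem_filter.1 hc).2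
    rw [weight, weight, hmem c hc, form_smul_left]
    split_ifs with h1 h2
    · have : R.form s t = 0 := by tauto
      rw [this, mul_zero]
    all_goals rfl

open Classical in
/-- The sum of a weight over the common neighbours of `0` and `s ⊗ t`. -/
theorem sum_neighbors_weight {j : ℕ} (R : RankFactorization Y (j + 1)) (φ : F → ℝ) (p r w : ℝ)
    {f : Matrix m n F → ℝ}
    (hf : ∀ s t, s ≠ 0 → t ≠ 0 → f (vecMulVec s t) = R.weight φ p r w s t)
    {s : m → F} {t : n → F} (hs : s ≠ 0) (ht : t ≠ 0) :
    ∑ Z : Matrix m n F with Z.rank = 1 ∧ (Z - vecMulVec s t).rank = 1, f Z =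
      (if s ∈ LinearMap.range Y.mulVecLin then
        (Fintype.card F : ℝ) ^ j * (∑ c, φ c) +
          ((Fintype.card F : ℝ) ^ Fintype.card n - (Fintype.card F : ℝ) ^ (j + 1)) * p - φ 0
      else (Fintype.card F : ℝ) ^ (j + 1) * r +
          ((Fintype.card F : ℝ) ^ Fintype.card n - (Fintype.card F : ℝ) ^ (j + 1)) * w - r) +
      (if t ∈ LinearMap.range Yᵀ.mulVecLin then
        (Fintype.card F : ℝ) ^ j * (∑ c, φ c) +
          ((Fintype.card F : ℝ) ^ Fintype.card m - (Fintype.card F : ℝ) ^ (j + 1)) * r - φ 0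
      else (Fintype.card F : ℝ) ^ (j + 1) * p +
          ((Fintype.card F : ℝ) ^ Fintype.card m - (Fintype.card F : ℝ) ^ (j + 1)) * w - p) -
      (if s ∈ LinearMap.range Y.mulVecLin ∧ t ∈ LinearMap.range Yᵀ.mulVecLin ∧ R.form s t ≠ 0 then
        (∑ c, φ c) - φ 0
      else ((Fintype.card F : ℝ) - 1) * R.weight φ p r w s t) - R.weight φ p r w s t := by
  rw [sum_common_neighbors f hs ht, ← R.sum_weight_right φ p r w hs, ← R.sum_weight_left φ p r w ht,
    ← R.sum_weight_smul φ p r w s t, hf s t hs ht]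
  congr 1
  congr 1
  · congr 1
    · exact Finset.sum_congr rfl fun t' ht' => hf _ _ hs (Finset.mem_filter.1 ht').2
    · exact Finset.sum_congr rfl fun s' hs' => hf _ _ (Finset.mem_filter.1 hs').2 ht
  · refine Finset.sum_congr rfl fun c hc => ?_
    rw [← smul_vecMulVec, hf _ _ (smul_ne_zero (Finset.mem_filter.1 hc).2 hs) ht]

end RankFactorization

theorem nonempty_rankFactorization (Y : Matrix m n F) : Nonempty (RankFactorization Y Y.rank) := by
  obtain ⟨P, Q, P', Q', h, hP, hQ⟩ := exists_rank_factorization Y rfl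
  exact ⟨⟨P, Q, P', Q', h, hP, hQ⟩⟩

end Profile

/-! ### Linearity of the Norton product. -/

section NortonProduct

set_option linter.unusedSectionVars false

variable {X : Type*} [Fintype X] [DecidableEq X]

theorem toImage_hatVec_apply (E : Matrix X X ℝ) (w p : X) :
    (toImage E (hatVec w) : X → ℝ) p = E p w := by
  change (E *ᵥ Pi.single w 1) p = E p w
  simp

theorem nortonMul_sum_smul {ι : Type*} (E : Matrix X X ℝ) (u : imageSpace E) (S : Finset ι)
    (c : ι → ℝ) (v : ι → imageSpace E) :
    nortonMul E u (∑ i ∈ S, c i • v i) = ∑ i ∈ S, c i • nortonMul E u (v i) := by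
  have h : (u : X → ℝ) * ((∑ i ∈ S, c i • v i : imageSpace E) : X → ℝ) =
      ∑ i ∈ S, c i • ((u : X → ℝ) * (v i : X → ℝ)) := by
    rw [Submodule.coe_sum, Finset.mul_sum]
    exact Finset.sum_congr rfl fun i _ => mul_smul_comm _ _ _
  rw [nortonMul, h, map_sum]
  simp only [map_smul, nortonMul]

theorem toImage_hatSet (E : Matrix X X ℝ) (S : Finset X) :
    toImage E (hatSet S) = ∑ z, (if z ∈ S then (1 : ℝ) else 0) • toImage E (hatVec z) := by
  rw [hatSet, map_sum]
  simp

end NortonProduct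

/-! ### Distance as rank, and Norton multiplication as local adjacency. -/

section Graph

set_option linter.unusedSectionVars false

variable {F : Type*} [Field F] [DecidableEq F] {D N : ℕ}

theorem rank_sub_le_length {x y : Vertex F D N} (p : (bilinearFormsGraph F D N).Walk x y) :
    (x - y).rank ≤ p.length := by
  induction p with
  | nil => simp
  | @cons u v w h p ih =>
    have h1 : (u - v).rank = 1 := h
    have h2 := rank_add_le (u - v) (v - w)
    rw [sub_add_sub_cancel] at h2
    rw [SimpleGraph.Walk.length_cons]
    omega

/-- In a factorization `x - y = P * Q`, the first column of `P` and the first row of `Q` pair to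
`1`, so subtracting their product is a step that lowers the rank by one. -/
theorem exists_walk_length_eq_rank (r : ℕ) : ∀ x y : Vertex F D N, (x - y).rank = r →
    ∃ p : (bilinearFormsGraph F D N).Walk x y, p.length = r := by
  induction r with
  | zero =>
    intro x y h
    obtain rfl : x = y := sub_eq_zero.1 (rank_eq_zero_iff.1 h)
    exact ⟨SimpleGraph.Walk.nil, rfl⟩
  | succ r ih =>
    intro x y h
    obtain ⟨R⟩ := h ▸ nonempty_rankFactorization (x - y)
    have hrank := R.rank_sub_vecMulVec (R.mem_range_iff.2 ⟨Pi.single 0 1, rfl⟩)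
      (R.transpose.mem_range_iff.2 ⟨Pi.single 0 1, rfl⟩)
    have hform : R.form (R.P *ᵥ Pi.single 0 1) (R.transpose.P *ᵥ Pi.single 0 1) = 1 :=
      (R.form_mulVec_mulVec _ _).trans (by simp)
    rw [if_pos hform, Nat.add_sub_cancel] at hrank
    set Z := vecMulVec (R.P *ᵥ Pi.single 0 1) (R.transpose.P *ᵥ Pi.single 0 1) with hZ
    have hZ1 : Z.rank = 1 := by
      have h1 := rank_add_le (x - y - Z) Z
      have h2 : Z.rank ≤ 1 := rank_vecMulVec_le _ _
      rw [sub_add_cancel] at h1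
      omega
    obtain ⟨p, hp⟩ := ih (x - Z) y (by rw [sub_right_comm, hrank])
    have hadj : (bilinearFormsGraph F D N).Adj x (x - Z) := by
      change (x - (x - Z)).rank = 1
      rw [sub_sub_cancel, hZ1]
    exact ⟨SimpleGraph.Walk.cons hadj p, by rw [SimpleGraph.Walk.length_cons, hp]⟩

theorem dist_eq_rank (x y : Vertex F D N) :
    (bilinearFormsGraph F D N).dist x y = (x - y).rank := by
  obtain ⟨p, hp⟩ := exists_walk_length_eq_rank _ x y rfl
  apply le_antisymm
  · rw [← hp]
    exact SimpleGraph.dist_le p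
  · obtain ⟨p', hp'⟩ := p.reachable.exists_walk_length_eq_dist
    rw [← hp']
    exact rank_sub_le_length p'

variable [Fintype F]

theorem mem_sphere_iff {i : ℕ} {x z : Vertex F D N} :
    z ∈ sphere (bilinearFormsGraph F D N) i x ↔ (z - x).rank = i := by
  rw [sphere, Finset.mem_filter, dist_eq_rank, rank_sub_comm]
  simp

theorem adjMatrix_eq_rankOneMatrix :
    (bilinearFormsGraph F D N).adjMatrix ℝ = rankOneMatrix F (Fin D) (Fin (N - D)) := by
  ext z w
  rw [SimpleGraph.adjMatrix_apply, rankOneMatrix]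
  exact if_congr Iff.rfl rfl rfl

theorem E₁_eq_thetaKernel (hD : 0 < D) (hN : D < N) :
    E₁ F D N = thetaKernel F (Fin D) (Fin (N - D)) := by
  have : Nonempty (Fin D) := ⟨⟨0, hD⟩⟩
  have : Nonempty (Fin (N - D)) := ⟨⟨0, by omega⟩⟩
  have h := isPrimitiveIdempotent_thetaKernel (F := F) (m := Fin D) (n := Fin (N - D))
    Fintype.card_pos
  rw [← secondLargestEigenvalue_rankOneMatrix, ← adjMatrix_eq_rankOneMatrix] at h
  exact (existsUnique_isPrimitiveIdempotent
    ((bilinearFormsGraph F D N).isHermitian_adjMatrix (R := ℝ)) _).unique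
    (isPrimitiveIdempotent_primitiveIdempotent _ _) h

/-- The Norton product of `E x̂` and `E ẑ` for adjacent vertices `x` and `z`. -/
theorem nortonMul_adjacent (hD : 0 < D) (hN : D < N) {x z : Vertex F D N}
    (hxz : (z - x).rank = 1) :
    nortonMul (E₁ F D N) (toImage (E₁ F D N) (hatVec x)) (toImage (E₁ F D N) (hatVec z)) =
      (Fintype.card (Vertex F D N) : ℝ)⁻¹ •
        ∑ w : Vertex F D N with (w - x).rank = 1 ∧ (w - z).rank = 1,
          toImage (E₁ F D N) (hatVec w) := by
  have hX : (Fintype.card (Vertex F D N) : ℝ) ≠ 0 := Nat.cast_ne_zero.2 Fintype.card_ne_zero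
  apply Subtype.ext
  funext p
  have hL : (nortonMul (E₁ F D N) (toImage (E₁ F D N) (hatVec x))
      (toImage (E₁ F D N) (hatVec z)) : Vertex F D N → ℝ) p =
      ∑ w, E₁ F D N p w * (E₁ F D N w x * E₁ F D N w z) := by
    simp only [← toImage_hatVec_apply (E₁ F D N) _]
    change ∑ w, _ = _
    refine Finset.sum_congr rfl fun w _ => ?_
    rw [toImage_hatVec_apply]
    rfl
  rw [hL, SetLike.val_smul, Submodule.coe_sum, Pi.smul_apply, Finset.sum_apply]
  simp only [toImage_hatVec_apply, E₁_eq_thetaKernel hD hN, thetaKernel]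
  rw [← Finset.mul_sum, smul_eq_mul]
  have h := sum_theta_triple p x z hxz
  -- Three entries of the idempotent contribute `|X|⁻¹ ^ 3`; the triple sum gives back one factor
  -- `|X|`.
  calc _ = (Fintype.card (Vertex F D N) : ℝ)⁻¹ ^ 3 *
      ∑ w : Vertex F D N, theta F (Fin D) (Fin (N - D)) (p - w).rank *
        (theta F (Fin D) (Fin (N - D)) (w - x).rank *
          theta F (Fin D) (Fin (N - D)) (w - z).rank) := by
        rw [Finset.mul_sum]
        exact Finset.sum_congr rfl fun w _ => by ring
    _ = _ := by
        rw [h]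
        field_simp

/-- An eigenvector of the local graph at `x` yields an eigenvector of the Norton multiplication
by `E x̂`. -/
theorem nortonMul_local_eigenvector (hD : 0 < D) (hN : D < N) (x : Vertex F D N)
    (f : Vertex F D N → ℝ) (η : ℝ)
    (hf : ∀ Z : Vertex F D N, Z.rank = 1 →
      ∑ Z' : Vertex F D N with Z'.rank = 1 ∧ (Z' - Z).rank = 1, f Z' = η * f Z) :
    nortonMul (E₁ F D N) (toImage (E₁ F D N) (hatVec x))
        (∑ z : Vertex F D N with (z - x).rank = 1, f (z - x) • toImage (E₁ F D N) (hatVec z)) =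
      ((Fintype.card (Vertex F D N) : ℝ)⁻¹ * η) •
        ∑ z : Vertex F D N with (z - x).rank = 1, f (z - x) • toImage (E₁ F D N) (hatVec z) := by
  rw [nortonMul_sum_smul, mul_smul, Finset.smul_sum (r := η)]
  rw [Finset.sum_congr rfl (g := fun z : Vertex F D N =>
    (Fintype.card (Vertex F D N) : ℝ)⁻¹ • ∑ w : Vertex F D N,
      (if (w - x).rank = 1 ∧ (w - z).rank = 1 then f (z - x) else 0) •
        toImage (E₁ F D N) (hatVec w)), ← Finset.smul_sum]
  · congr 1
    -- After exchanging the sums, the coefficient of `E ŵ` is the sum of `f` over the local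
    -- neighbours of `w`, which is `η` times its value at `w`.
    rw [Finset.sum_comm, Finset.sum_filter]
    refine Finset.sum_congr rfl fun w _ => ?_
    rw [← Finset.sum_smul]
    split_ifs with h
    · rw [smul_smul, ← hf _ h, Finset.sum_filter, Finset.sum_filter,
        ← Equiv.sum_comp (Equiv.subRight x) fun Z : Vertex F D N =>
          if Z.rank = 1 ∧ (Z - (w - x)).rank = 1 then f Z else 0]
      congr 1
      refine Finset.sum_congr rfl fun z _ => ?_
      rw [Equiv.subRight_apply, sub_sub_sub_cancel_right, rank_sub_comm z w]
      by_cases hz : (z - x).rank = 1 <;> simp [hz, h]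
    · simp [h]
  · intro z hz
    rw [nortonMul_adjacent hD hN (Finset.mem_filter.1 hz).2, smul_comm, Finset.sum_filter,
      Finset.smul_sum]
    congr 1
    refine Finset.sum_congr rfl fun w _ => ?_
    split_ifs <;> simp

end Graph

/-! ### The cells of the partition and the eigenvectors of its quotient matrix. -/

section Partition

set_option linter.unusedSectionVars false

variable {F : Type*} [Field F] [Fintype F] [DecidableEq F] {D N : ℕ}

theorem mem_middlePart_iff {x y z : Vertex F D N} {a b : ℕ} :
    z ∈ middlePart x y a b ↔ (z - x).rank = 1 ∧ (z - y).rank = (x - y).rank ∧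
      (sphere (bilinearFormsGraph F D N) 1 x ∩ sphere (bilinearFormsGraph F D N) 1 z ∩
        sphere (bilinearFormsGraph F D N) ((x - y).rank - 1) y).card = a ∧
      (sphere (bilinearFormsGraph F D N) 1 x ∩ sphere (bilinearFormsGraph F D N) 1 z ∩
        sphere (bilinearFormsGraph F D N) ((x - y).rank + 1) y).card = b := by
  rw [middlePart]
  simp only [dist_eq_rank, Finset.mem_filter, Finset.mem_inter, mem_sphere_iff, and_assoc]

theorem card_common_neighbors (x y Z : Vertex F D N) (i : ℕ) :
    ((sphere (bilinearFormsGraph F D N) 1 x ∩ sphere (bilinearFormsGraph F D N) 1 (x + Z) ∩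
        sphere (bilinearFormsGraph F D N) i y).card : ℝ) =
      ∑ Z' : Vertex F D N with Z'.rank = 1 ∧ (Z' - Z).rank = 1,
        if (y - x - Z').rank = i then (1 : ℝ) else 0 := by
  rw [← Finset.sum_filter, Finset.filter_filter, Finset.sum_const, nsmul_one]
  congr 1
  refine Finset.card_bij (fun z _ => z - x) ?_ (fun _ _ _ _ h => sub_left_injective h) ?_
  · intro z hz
    simp only [Finset.mem_inter, mem_sphere_iff] at hz
    rw [Finset.mem_filter, sub_sub, sub_sub_sub_cancel_right, rank_sub_comm y]
    exact ⟨Finset.mem_univ _, hz⟩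
  · intro Z' hZ'
    rw [Finset.mem_filter] at hZ'
    refine ⟨x + Z', ?_, add_sub_cancel_left _ _⟩
    simp only [Finset.mem_inter, mem_sphere_iff]
    rw [add_sub_cancel_left, add_sub_add_left_eq_sub, rank_sub_comm _ y, ← sub_sub]
    exact hZ'.2

namespace RankFactorization

variable {j : ℕ} {x y : Vertex F D N}

theorem rank_indicator_pred (R : RankFactorization (y - x) (j + 1)) (s : Fin D → F)
    (t : Fin (N - D) → F) :
    (if (y - x - vecMulVec s t).rank = j then (1 : ℝ) else 0) =
      R.weight (fun c => if c = 1 then 1 else 0) 0 0 0 s t := by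
  rw [weight]
  by_cases hs : s ∈ LinearMap.range (y - x).mulVecLin <;>
    by_cases ht : t ∈ LinearMap.range (y - x)ᵀ.mulVecLin
  · rw [if_pos hs, if_pos ht, R.rank_sub_vecMulVec hs ht]
    split_ifs <;> first | rfl | omega
  · rw [if_pos hs, if_neg ht, rank_sub_vecMulVec_of_mem_left hs ht, R.rank_eq]
    simp
  · rw [if_neg hs, if_pos ht, rank_sub_vecMulVec_of_mem_right hs ht, R.rank_eq]
    simp
  · rw [if_neg hs, if_neg ht, rank_sub_vecMulVec_of_notMem hs ht, R.rank_eq]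
    simp [add_assoc]

theorem rank_indicator_succ (R : RankFactorization (y - x) (j + 1)) (s : Fin D → F)
    (t : Fin (N - D) → F) :
    (if (y - x - vecMulVec s t).rank = j + 2 then (1 : ℝ) else 0) =
      R.weight (fun _ => 0) 0 0 1 s t := by
  rw [weight]
  by_cases hs : s ∈ LinearMap.range (y - x).mulVecLin <;>
    by_cases ht : t ∈ LinearMap.range (y - x)ᵀ.mulVecLin
  · rw [if_pos hs, if_pos ht, R.rank_sub_vecMulVec hs ht]
    split_ifs <;> first | rfl | omega
  · rw [if_pos hs, if_neg ht, rank_sub_vecMulVec_of_mem_left hs ht, R.rank_eq]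
    simp
  · rw [if_neg hs, if_pos ht, rank_sub_vecMulVec_of_mem_right hs ht, R.rank_eq]
    simp
  · rw [if_neg hs, if_neg ht, rank_sub_vecMulVec_of_notMem hs ht, R.rank_eq]
    simp [add_assoc]

/-- The value at `x + s ⊗ t` of a function that is constant on the cells of the `y`-partition. -/
theorem sum_yPartition_eq_weight (R : RankFactorization (y - x) (j + 1)) (hj : 1 ≤ j)
    (hjD : j + 1 < D) (hN : 2 * D < N) (h : Fin 6 → ℝ) {s : Fin D → F} {t : Fin (N - D) → F}
    (hs : s ≠ 0) (ht : t ≠ 0) :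
    ∑ i, h i * (if x + vecMulVec s t ∈ yPartition x y i then 1 else 0) =
      R.weight (fun c => if c = 1 then h 0 else if c = 0 then h 1 else h 2) (h 3) (h 4) (h 5)
        s t := by
  have hq : 1 < Fintype.card F := Fintype.one_lt_card
  have hxy : (x - y).rank = j + 1 := by rw [rank_sub_comm, R.rank_eq]
  -- Both counts defining the middle cells are neighbour sums of indicator weights, so the closed
  -- formula evaluates them.
  have hL := (card_common_neighbors x y (vecMulVec s t) j).trans
    (R.sum_neighbors_weight (fun c => if c = 1 then 1 else 0) 0 0 0
      (fun s t _ _ => R.rank_indicator_pred s t) hs ht)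
  have hU := (card_common_neighbors x y (vecMulVec s t) (j + 2)).trans
    (R.sum_neighbors_weight (fun _ => 0) 0 0 1 (fun s t _ _ => R.rank_indicator_succ s t) hs ht)
  set L := (sphere (bilinearFormsGraph F D N) 1 x ∩ sphere (bilinearFormsGraph F D N) 1
      (x + vecMulVec s t) ∩ sphere (bilinearFormsGraph F D N) j y).card
  set U := (sphere (bilinearFormsGraph F D N) 1 x ∩ sphere (bilinearFormsGraph F D N) 1
      (x + vecMulVec s t) ∩ sphere (bilinearFormsGraph F D N) (j + 2) y).card
  have h1 : (x + vecMulVec s t - x).rank = 1 := by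
    rw [add_sub_cancel_left, rank_vecMulVec_eq_one hs ht]
  have hzy : (x + vecMulVec s t - y).rank = (y - x - vecMulVec s t).rank := by
    rw [rank_sub_comm, sub_sub]
  have hmid : ∀ a b : ℕ, x + vecMulVec s t ∈ middlePart x y a b ↔
      (y - x - vecMulVec s t).rank = j + 1 ∧ L = a ∧ U = b := by
    intro a b
    rw [mem_middlePart_iff, hzy, hxy]
    exact and_iff_right h1
  have hsph : ∀ i : ℕ, x + vecMulVec s t ∈ sphere (bilinearFormsGraph F D N) 1 x ∩
      sphere (bilinearFormsGraph F D N) i y ↔ (y - x - vecMulVec s t).rank = i := by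
    intro i
    rw [Finset.mem_inter, mem_sphere_iff, mem_sphere_iff, hzy]
    exact and_iff_right h1
  set q := Fintype.card F with hqdef
  -- These inequalities keep the cells apart: `2 ≤ q ^ j` separates `2 * q ^ j - 1` from `q ^ j`,
  -- and `q ^ D < q ^ (N - D)` separates the two one-sided cells.
  have hqj : 2 ≤ q ^ j := (show 2 ≤ q by omega).trans (Nat.le_self_pow (by omega) q)
  have hA : q ^ (j + 1) < q ^ D := Nat.pow_lt_pow_right hq hjD
  have hB : q ^ D < q ^ (N - D) := Nat.pow_lt_pow_right hq (by omega)
  have hsum : ∑ i, h i * (if x + vecMulVec s t ∈ yPartition x y i then 1 else 0) =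
      h 0 * (if (y - x - vecMulVec s t).rank = j then 1 else 0) +
      h 1 * (if (y - x - vecMulVec s t).rank = j + 1 ∧ L = 2 * q ^ j ∧ U = 0 then 1 else 0) +
      h 2 * (if (y - x - vecMulVec s t).rank = j + 1 ∧ L = 2 * q ^ j - 1 ∧ U = 0
        then 1 else 0) +
      h 3 * (if (y - x - vecMulVec s t).rank = j + 1 ∧ L = q ^ j ∧ U = q ^ D - q ^ (j + 1)
        then 1 else 0) +
      h 4 * (if (y - x - vecMulVec s t).rank = j + 1 ∧ L = q ^ j ∧
        U = q ^ (N - D) - q ^ (j + 1) then 1 else 0) +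
      h 5 * (if (y - x - vecMulVec s t).rank = j + 2 then 1 else 0) := by
    rw [Fin.sum_univ_six]
    simp [yPartition, dist_eq_rank, hxy, hmid, hsph, add_assoc, -Finset.mem_inter, ← hqdef]
  rw [hsum]
  clear_value L U
  by_cases hsW : s ∈ LinearMap.range (y - x).mulVecLin <;>
    by_cases htU : t ∈ LinearMap.range (y - x)ᵀ.mulVecLin
  · have hr := R.rank_sub_vecMulVec hsW htU
    simp only [weight, hsW, htU, if_true, true_and] at hL hU ⊢
    rw [hr]
    by_cases hb1 : R.form s t = 1
    · simp [hb1]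
    · have hU' : U = 0 := by
        have : (U : ℝ) = 0 := by rw [hU]; simp
        exact_mod_cast this
      by_cases hb0 : R.form s t = 0
      · have hL' : L = 2 * q ^ j := by
          have : (L : ℝ) = 2 * (q : ℝ) ^ j := by rw [hL]; simp [hb0]; ring
          exact_mod_cast this
        have hne : 2 * q ^ j ≠ 2 * q ^ j - 1 := by omega
        have hne' : 2 * q ^ j ≠ q ^ j := by omega
        simp [hb0, hL', hU', hne, hne']
      -- A nonzero value of the form gives exactly one multiple of `s ⊗ t` with value `1`. It occurs
      -- among both the row and the column neighbours, hence the `- 1`.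
      · have hL' : L = 2 * q ^ j - 1 := by
          have : (L : ℝ) + 1 = 2 * (q : ℝ) ^ j := by rw [hL]; simp [hb0, hb1]; ring
          have : L + 1 = 2 * q ^ j := by exact_mod_cast this
          omega
        have hne : 2 * q ^ j - 1 ≠ 2 * q ^ j := by omega
        have hne' : 2 * q ^ j - 1 ≠ q ^ j := by omega
        simp [hb0, hb1, hL', hU', hne, hne']
  · have hr := rank_sub_vecMulVec_of_mem_left hsW htU
    simp only [weight, hsW, htU, if_true, if_false, false_and, and_false] at hL hU ⊢
    rw [hr, R.rank_eq]
    have hL' : L = q ^ j := by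
      have : (L : ℝ) = (q : ℝ) ^ j := by rw [hL]; simp
      exact_mod_cast this
    have hU' : U = q ^ D - q ^ (j + 1) := by
      have : (U : ℝ) + (q : ℝ) ^ (j + 1) = (q : ℝ) ^ D := by rw [hU]; simp
      have : U + q ^ (j + 1) = q ^ D := by exact_mod_cast this
      omega
    have e1 : q ^ j ≠ 2 * q ^ j := by omega
    have e2 : q ^ j ≠ 2 * q ^ j - 1 := by omega
    have e3 : q ^ D - q ^ (j + 1) ≠ q ^ (N - D) - q ^ (j + 1) := by omega
    simp [hL', hU', e1, e2, e3]
  · have hr := rank_sub_vecMulVec_of_mem_right hsW htU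
    simp only [weight, hsW, htU, if_true, if_false, false_and] at hL hU ⊢
    rw [hr, R.rank_eq]
    have hL' : L = q ^ j := by
      have : (L : ℝ) = (q : ℝ) ^ j := by rw [hL]; simp
      exact_mod_cast this
    have hU' : U = q ^ (N - D) - q ^ (j + 1) := by
      have : (U : ℝ) + (q : ℝ) ^ (j + 1) = (q : ℝ) ^ (N - D) := by rw [hU]; simp
      have : U + q ^ (j + 1) = q ^ (N - D) := by exact_mod_cast this
      omega
    have e1 : q ^ j ≠ 2 * q ^ j := by omega
    have e2 : q ^ j ≠ 2 * q ^ j - 1 := by omega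
    have e3 : q ^ (N - D) - q ^ (j + 1) ≠ q ^ D - q ^ (j + 1) := by omega
    simp [hL', hU', e1, e2, e3]
  · have hr := rank_sub_vecMulVec_of_notMem hsW htU
    simp only [weight, hsW, htU, if_false]
    rw [hr, R.rank_eq]
    simp [add_assoc]

end RankFactorization

theorem sum_three_values (a b c : ℝ) :
    (∑ t : F, if t = 1 then a else if t = 0 then b else c) =
      a + b + ((Fintype.card F : ℝ) - 2) * c := by
  have h : ∀ t : F, (if t = 1 then a else if t = 0 then b else c) =
      (if t = 1 then a - c else 0) + (if t = 0 then b - c else 0) + c := by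
    intro t
    by_cases h1 : t = 1
    · subst h1
      simp
    · by_cases h0 : t = 0 <;> simp [h0, h1]
  rw [Finset.sum_congr rfl fun t _ => h t, Finset.sum_add_distrib, Finset.sum_add_distrib]
  simp
  ring

/-- The columns of `H` are right eigenvectors of the quotient matrix of the `y`-partition. -/
theorem HMatrix_quotient_eq {q : ℝ} (hq : 1 < q) {D N j : ℕ} (hN : D ≤ N) (l : Fin 6) :
    let H := fun i => HMatrix q D N (j + 1) i l
    let S := q ^ j * (H 0 + H 1 + (q - 2) * H 2)
    let a := q ^ D - q ^ (j + 1)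
    let b := q ^ (N - D) - q ^ (j + 1)
    let v := vartheta q D N l
    (S + b * H 3 - H 1) + (S + a * H 4 - H 1) - (H 0 + H 1 + (q - 2) * H 2 - H 1) - H 0 =
        v * H 0 ∧
    (S + b * H 3 - H 1) + (S + a * H 4 - H 1) - (q - 1) * H 1 - H 1 = v * H 1 ∧
    (S + b * H 3 - H 1) + (S + a * H 4 - H 1) - (H 0 + H 1 + (q - 2) * H 2 - H 1) - H 2 =
        v * H 2 ∧
    (S + b * H 3 - H 1) + (q ^ (j + 1) * H 3 + a * H 5 - H 3) - (q - 1) * H 3 - H 3 = v * H 3 ∧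
    (q ^ (j + 1) * H 4 + b * H 5 - H 4) + (S + a * H 4 - H 1) - (q - 1) * H 4 - H 4 = v * H 4 ∧
    (q ^ (j + 1) * H 4 + b * H 5 - H 4) + (q ^ (j + 1) * H 3 + a * H 5 - H 3) - (q - 1) * H 5 -
      H 5 = v * H 5 := by
  have hNs : q ^ N = q ^ D * q ^ (N - D) := by rw [← pow_add, Nat.add_sub_cancel' hN]
  have hq1 : q - 1 ≠ 0 := by linarith
  have hq0 : q ≠ 0 := by linarith
  have hQ : q ^ j ≠ 0 := pow_ne_zero _ hq0
  simp only [HMatrix, vartheta, Nat.add_sub_cancel, pow_succ, hNs]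
  -- Once `q ^ N` is split as a product, the identities hold with `q ^ D`, `q ^ (N - D)` and `q ^ j`
  -- as independent variables.
  generalize q ^ D = A
  generalize q ^ (N - D) = B
  generalize q ^ j = Q at hQ ⊢
  fin_cases l <;> simp <;> refine ⟨?_, ?_, ?_, ?_, ?_, ?_⟩ <;> field_simp <;> ring

theorem yPartition_subset (x y : Vertex F D N) (i : Fin 6) {z : Vertex F D N}
    (hz : z ∈ yPartition x y i) : (z - x).rank = 1 := by
  have hs : ∀ l, z ∈ sphere (bilinearFormsGraph F D N) 1 x ∩
      sphere (bilinearFormsGraph F D N) l y → (z - x).rank = 1 := fun l h =>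
    mem_sphere_iff.1 (Finset.mem_inter.1 h).1
  have hm : ∀ a b, z ∈ middlePart x y a b → (z - x).rank = 1 := fun a b h =>
    (mem_middlePart_iff.1 h).1
  fin_cases i
  · exact hs _ hz
  · exact hm _ _ hz
  · exact hm _ _ hz
  · exact hm _ _ hz
  · exact hm _ _ hz
  · exact hs _ hz

/-- The cells lie in `Γ(x)`, so the combination is a sum over neighbours. Writing `x + (z - x)`
exhibits the coefficient as a function of `z - x`, as `nortonMul_local_eigenvector` requires. -/
theorem hVec_eq_sum (x y : Vertex F D N) (l : Fin 6) :
    hVec x y l = ∑ z : Vertex F D N with (z - x).rank = 1,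
      (∑ i, HMatrix (Fintype.card F) D N ((bilinearFormsGraph F D N).dist x y) i l *
        (if x + (z - x) ∈ yPartition x y i then 1 else 0)) • toImage (E₁ F D N) (hatVec z) := by
  simp only [hVec, toImage_hatSet, Finset.smul_sum, smul_smul]
  rw [Finset.sum_comm, Finset.sum_filter]
  refine Finset.sum_congr rfl fun z _ => ?_
  rw [← Finset.sum_smul, add_sub_cancel]
  split_ifs with h
  · rfl
  · rw [Finset.sum_eq_zero, zero_smul]
    intro i _
    rw [if_neg fun hz => h (yPartition_subset x y i hz), mul_zero]

end Partition

end BalancedSet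

/-! ### Reduction to the quotient matrix. -/

open BalancedSet in
theorem proposition11p16 {F : Type*} [Field F] [Fintype F] [DecidableEq F]
    (hq : Fintype.card F ≠ 2) (D N : ℕ) (hD : 3 ≤ D) (hN : 2 * D < N)
    (x y : BalancedSet.Vertex F D N)
    (hk2 : 2 ≤ (BalancedSet.bilinearFormsGraph F D N).dist x y)
    (hkD : (BalancedSet.bilinearFormsGraph F D N).dist x y ≤ D - 1)
    (j : Fin 6) :
    BalancedSet.nortonMul (BalancedSet.E₁ F D N)
        (BalancedSet.toImage (BalancedSet.E₁ F D N) (BalancedSet.hatVec x))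
        (BalancedSet.hVec x y j) =
      ((Fintype.card (BalancedSet.Vertex F D N) : ℝ)⁻¹ *
        BalancedSet.vartheta (Fintype.card F) D N j) • BalancedSet.hVec x y j := by
  have hrank := dist_eq_rank x y
  obtain ⟨k, hk⟩ : ∃ k, (bilinearFormsGraph F D N).dist x y = k + 1 :=
    ⟨(bilinearFormsGraph F D N).dist x y - 1, by omega⟩
  have hyx : (y - x).rank = k + 1 := by rw [rank_sub_comm, ← hrank, hk]
  obtain ⟨R⟩ := hyx ▸ nonempty_rankFactorization (y - x)
  rw [hVec_eq_sum]
  refine nortonMul_local_eigenvector (by omega) (by omega) x (fun Z => ∑ i, HMatrix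
    (Fintype.card F) D N ((bilinearFormsGraph F D N).dist x y) i j *
      (if x + Z ∈ yPartition x y i then 1 else 0)) _ fun Z hZ => ?_
  obtain ⟨s, t, hs, ht, rfl⟩ := exists_eq_vecMulVec_of_rank_eq_one hZ
  have hf := fun (s : Fin D → F) (t : Fin (N - D) → F) (hs : s ≠ 0) (ht : t ≠ 0) =>
    R.sum_yPartition_eq_weight (by omega) (by omega) hN
      (fun i => HMatrix (Fintype.card F) D N ((bilinearFormsGraph F D N).dist x y) i j) hs ht
  rw [R.sum_neighbors_weight _ _ _ _ hf hs ht, hf s t hs ht, hk, sum_three_values]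
  have hq1 : (1 : ℝ) < Fintype.card F := by
    exact_mod_cast (Fintype.one_lt_card : 1 < Fintype.card F)
  obtain ⟨e0, e1, e2, e3, e4, e5⟩ :=
    HMatrix_quotient_eq hq1 (D := D) (N := N) (j := k) (by omega) j
  simp only [RankFactorization.weight, Fintype.card_fin]
  -- The positions of `s` and `t`, with the three kinds of form values when both are inside, give
  -- six cases, one for each row of the quotient equations.
  by_cases hsW : s ∈ LinearMap.range (y - x).mulVecLin <;>
    by_cases htU : t ∈ LinearMap.range (y - x)ᵀ.mulVecLin
  all_goals
    simp only [hsW, htU, if_true, if_false, true_and, false_and, and_false]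
  · by_cases h1 : R.form s t = 1
    · simpa [h1] using e0
    · by_cases h0 : R.form s t = 0
      · simpa [h0] using e1
      · simpa [h0, h1] using e2
  · simpa using e3
  · simpa using e4
  · simpa using e5
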